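/- **Setting.** Graphs are in Serre's sense: a graph $X$ has a vertex set $V_X$, a set of directed edges $\mathbf E_X$, origin and terminus maps $o,t:\mathbf E_X\to V_X$, and a fixed-point free involution $e\mapsto\bar e$ of $\mathbf E_X$ with $o(\bar e)=t(e)$. $\mathrm{Div}(X)$ is the free abelian group on $V_X$, $s:\mathrm{Div}(X)\to\mathbb Z$ the degree map, and $\mathrm{Div}^0(X)=\ker s$. For $X$ locally finite, $\mathrm{Pr}(X)$ is the image of the Laplacian $v\mapsto \mathrm{val}_X(v)\,v-\sum_{o(e)=v}t(e)$, where $\mathrm{val}_X(v)=|\{e : o(e)=v\}|$; and $\mathrm{Pic}(X)=\mathrm{Div}(X)/\mathrm{Pr}(X)$, $\mathrm{Pic}^0(X)=\mathrm{Div}^0(X)/\mathrm{Pr}(X)$. For a prime $p$ and an abelian group $M$ put $M_p=\mathbb Z_p\otimes_{\mathbb Z}M$; this defines $\mathrm{Div}_p$, $\mathrm{Pic}_p$, $\mathrm{Pic}^0_p$. Let $p$ be a prime, $\Gamma$ a multiplicative topological group topologically isomorphic to $\mathbb Z_p$, $\gamma$ a topological generator, $\Gamma_n=\Gamma/\Gamma^{p^n}$,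 and $\Lambda=\varprojlim_n\mathbb Z_p[\Gamma_n]$, with the natural map $\mathbb Z_p[\Gamma]\to\Lambda$. Put $\omega_n=\gamma^{p^n}-1$ and, for $k\le n$, $\omega_{n,k}=\sum_{j=0}^{p^{n-k}-1}\gamma^{jp^k}$. Let $X$ be a finite connected graph, $\alpha:\mathbf E_X\to\Gamma$ a function with $\alpha(\bar e)=\alpha(e)^{-1}$, and $(I_v)_{v\in V_X}$ closed subgroups of $\Gamma$. The graph $X_\infty$ has vertices $(v,\sigma I_v)$ with $v\in V_X$, $\sigma\in\Gamma$, and directed edges $(e,\sigma)\in\mathbf E_X\times\Gamma$, going from $(o(e),\sigma I_{o(e)})$ to $(t(e),\sigma\alpha(e)I_{t(e)})$, with $\overline{(e,\sigma)}=(\bar e,\sigma\alpha(e))$. The finite graph $X_n$ is defined in the same way from $\Gamma_n$ and the images of $\alpha$ and of the $I_v$ in $\Gamma_n$. Assume that all $X_n$, $n\ge0$, are connected. The groups $\Gamma$ and $\Gamma_n$ act on $X_\infty$ and $X_n$ by left multiplication, so $\mathrm{Div}_p(X_\infty)$ is a $\mathbb Z_p[\Gamma]$-module, and $\mathrm{Div}_p(X_n)$,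 $\mathrm{Pic}_p(X_n)$, $\mathrm{Pic}_p^0(X_n)$ are $\mathbb Z_p[\Gamma_n]$-modules, hence $\Lambda$-modules. The natural maps $X_{n+1}\to X_n$ induce $\mathrm{Pic}_p(X_{n+1})\to\mathrm{Pic}_p(X_n)$ and likewise for $\mathrm{Pic}^0_p$; let $\mathrm{Pic}_\Lambda=\varprojlim_{n\ge0}\mathrm{Pic}_p(X_n)$ and $\mathrm{Pic}^0_\Lambda=\varprojlim_{n\ge0}\mathrm{Pic}^0_p(X_n)$, which are $\Lambda$-modules. Let $\mathrm{Div}_\Lambda(X_\infty)=\Lambda\otimes_{\mathbb Z_p[\Gamma]}\mathrm{Div}_p(X_\infty)$, and let $\mathrm{Div}^0_\Lambda(X_\infty)$ be the kernel of $\mathrm{id}\otimes s_p:\mathrm{Div}_\Lambda(X_\infty)\to\Lambda\otimes_{\mathbb Z_p[\Gamma]}\mathbb Z_p$, where $s_p$ is the degree map and $\Gamma$ acts trivially on $\mathbb Z_p$. Let $\pi_n:\mathrm{Div}_\Lambda(X_\infty)\to\mathrm{Div}_p(X_n)$ be the $\Lambda$-linear map induced by $X_\infty\to X_n$. For $v\in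 V_X$ put $$P_{v,\infty}=\mathrm{val}_X(v)\,(v,I_v)-\sum_{o(e)=v}(t(e),\alpha(e)I_{t(e)})\in\mathrm{Div}_\Lambda(X_\infty).$$ Call $v$ ramified if $I_v\neq1$, in which case $I_v=\Gamma^{p^{k_v}}$ for a unique $k_v\ge0$, and unramified otherwise. Let $\mathrm{Pr}^{unr}_\Lambda$ be the $\Lambda$-submodule generated by the $P_{v,\infty}$ with $v$ unramified, $\mathrm{Pr}^{ram}_{\Lambda,n}$ the one generated by the $\omega_{n,k_v}P_{v,\infty}$ with $v$ ramified, and $$N_n=\omega_n\mathrm{Div}_\Lambda(X_\infty)+\mathrm{Pr}^{ram}_{\Lambda,n}+\mathrm{Pr}^{unr}_\Lambda .$$ **Theorem.** 1. (Finite level.) Let $n\ge k_v$ for all ramified $v$. Then $N_n\subseteq\mathrm{Div}^0_\Lambda(X_\infty)$, and $\pi_n$ induces isomorphisms of $\Lambda$-modules $$\mathrm{Div}_\Lambda(X_\infty)/N_n\xrightarrow{\ \simeq\ }\mathrm{Pic}_p(X_n),\qquad \mathrm{Div}^0_\Lambda(X_\infty)/N_n\xrightarrow{\ \simeq\ }\mathrm{Pic}^0_p(X_n).$$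 2. (Infinite level.) $\mathrm{Pr}^{unr}_\Lambda\subseteq\mathrm{Div}^0_\Lambda(X_\infty)$, and the maps $\pi_n$, $n\ge0$, induce isomorphisms of $\Lambda$-modules $$\mathrm{Div}_\Lambda(X_\infty)/\mathrm{Pr}^{unr}_\Lambda\xrightarrow{\ \simeq\ }\mathrm{Pic}_\Lambda,\qquad \mathrm{Div}^0_\Lambda(X_\infty)/\mathrm{Pr}^{unr}_\Lambda\xrightarrow{\ \simeq\ }\mathrm{Pic}^0_\Lambda.$$ -/

import Mathlib

open scoped TensorProduct

universe u v

noncomputable section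

/-! ## Graphs in Serre's formalism -/

/-- A graph: vertices, directed edges, origin, terminus, and a fixed-point free inversion of the
directed edges exchanging origin and terminus. -/
structure SerreGraph where
  V : Type u
  E : Type v
  o : E → V
  t : E → V
  inv : E → E
  inv_ne : ∀ e, inv e ≠ e
  inv_inv : ∀ e, inv (inv e) = e
  o_inv : ∀ e, o (inv e) = t e
  t_inv : ∀ e, t (inv e) = o e

namespace SerreGraph

/-- The directed edges with origin `v`. -/
def star (X : SerreGraph) (v : X.V) : Set X.E := {e | X.o e = v}

/-- The valency of `v` (used for vertices with finitely many outgoing edges). -/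
def val (X : SerreGraph) (v : X.V) : ℕ := Nat.card (X.star v)

/-- Any two vertices are joined by a path of directed edges. -/
def Connected (X : SerreGraph) : Prop :=
  ∀ v w : X.V, Relation.ReflTransGen (fun a b => ∃ e : X.E, X.o e = a ∧ X.t e = b) v w

/-! ### Divisors -/

/-- `Div(X)`, the free abelian group on the vertices. -/
def Div (X : SerreGraph) : Type _ := X.V →₀ ℤ

instance (X : SerreGraph) : AddCommGroup X.Div := inferInstanceAs (AddCommGroup (X.V →₀ ℤ))

/-- A vertex, seen as a divisor. -/
def vertex (X : SerreGraph) (v : X.V) : X.Div := Finsupp.single v (1 : ℤ)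

/-- The additive map out of `Div(X)` with prescribed values on the vertices. -/
def Div.lift {X : SerreGraph} {A : Type*} [AddCommGroup A] (f : X.V → A) : X.Div →+ A :=
  Finsupp.liftAddHom (fun v => zmultiplesHom A (f v))

@[simp] theorem Div.lift_vertex {X : SerreGraph} {A : Type*} [AddCommGroup A] (f : X.V → A)
    (v : X.V) : Div.lift f (X.vertex v) = f v := by
  have h := Finsupp.liftAddHom_apply_single (fun v => zmultiplesHom A (f v)) v (1 : ℤ)
  refine h.trans ?_
  simp

theorem Div.hom_ext {X : SerreGraph} {A : Type*} [AddCommGroup A] {f g : X.Div →+ A}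
    (h : ∀ v, f (X.vertex v) = g (X.vertex v)) : f = g := by
  have : ∀ f g : (X.V →₀ ℤ) →+ A,
      (∀ v, f (Finsupp.single v 1) = g (Finsupp.single v 1)) → f = g := by
    intro f g h
    apply Finsupp.addHom_ext'
    intro v
    ext
    simpa using h v
  exact this f g h

/-- The degree map `s : Div(X) → ℤ`. -/
def deg (X : SerreGraph) : X.Div →+ ℤ := Div.lift (fun _ => (1 : ℤ))

/-- `Div⁰(X)`, the divisors of degree zero. -/
def Div0 (X : SerreGraph) : AddSubgroup X.Div := X.deg.ker

/-- The Laplacian `v ↦ val(v) v - ∑_{o(e) = v} t(e)`, for locally finite graphs. -/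
def laplacian (X : SerreGraph) : X.Div →+ X.Div :=
  Div.lift (fun v => X.val v • X.vertex v - ∑ᶠ e : X.star v, X.vertex (X.t e))

theorem laplacian_vertex (X : SerreGraph) (v : X.V) : X.laplacian (X.vertex v) =
    X.val v • X.vertex v - ∑ᶠ e : X.star v, X.vertex (X.t e) := Div.lift_vertex _ _

theorem laplacian_vertex_of_finite (X : SerreGraph) (v : X.V) [Fintype (X.star v)] :
    X.laplacian (X.vertex v) = ∑ e : X.star v, (X.vertex v - X.vertex (X.t e)) := by
  rw [laplacian_vertex, Finset.sum_sub_distrib, finsum_eq_sum_of_fintype, val,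
    Nat.card_eq_fintype_card]
  simp

theorem laplacian_vertex_of_infinite (X : SerreGraph) (v : X.V) (h : Infinite (X.star v)) :
    X.laplacian (X.vertex v) = 0 := by
  have h1 : X.val v = 0 := Nat.card_eq_zero_of_infinite
  have h2 : ∑ᶠ e : X.star v, X.vertex (X.t e) = 0 := by
    apply finsum_of_infinite_support
    have : (Function.support fun e : X.star v => X.vertex (X.t e)) = Set.univ := by
      ext e
      simp only [Function.mem_support, Set.mem_univ, iff_true]
      exact Finsupp.single_ne_zero.mpr one_ne_zero
    rw [this]
    exact Set.infinite_univ
  rw [laplacian_vertex, h1, h2]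
  simp

/-- `Pr(X)`, the image of the Laplacian. -/
def Pr (X : SerreGraph) : AddSubgroup X.Div := X.laplacian.range

/-- `Pic(X) = Div(X) / Pr(X)`. -/
def Pic (X : SerreGraph) : Type _ := X.Div ⧸ X.Pr

instance (X : SerreGraph) : AddCommGroup X.Pic := inferInstanceAs (AddCommGroup (X.Div ⧸ X.Pr))

/-- `Pic⁰(X) = Div⁰(X) / Pr(X)`. -/
def Pic0 (X : SerreGraph) : Type _ := X.Div0 ⧸ X.Pr.addSubgroupOf X.Div0

instance (X : SerreGraph) : AddCommGroup X.Pic0 :=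
  inferInstanceAs (AddCommGroup (X.Div0 ⧸ X.Pr.addSubgroupOf X.Div0))

/-- The class of a divisor. -/
def Pic.mk (X : SerreGraph) : X.Div →+ X.Pic := QuotientAddGroup.mk' X.Pr

/-- The map `Pic⁰(X) → Pic(X)` induced by the inclusion `Div⁰(X) ⊆ Div(X)`. -/
def Pic0.toPic (X : SerreGraph) : X.Pic0 →+ X.Pic :=
  QuotientAddGroup.map (X.Pr.addSubgroupOf X.Div0) X.Pr X.Div0.subtype le_rfl

/-! ### Morphisms and branched covers -/

/-- A morphism of graphs. -/
structure Hom (Y X : SerreGraph) where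
  onV : Y.V → X.V
  onE : Y.E → X.E
  o_onE : ∀ e, X.o (onE e) = onV (Y.o e)
  t_onE : ∀ e, X.t (onE e) = onV (Y.t e)
  inv_onE : ∀ e, X.inv (onE e) = onE (Y.inv e)

namespace Hom

variable {Y X : SerreGraph}

/-- The edges with origin `w` above a given edge. -/
def fibre (f : Hom Y X) (w : Y.V) (e : X.E) : Set Y.E := {e' | Y.o e' = w ∧ f.onE e' = e}

/-- Branched covers: surjective, and for each vertex `w` the number of edges at `w` above an edge
`e` at the image of `w` does not depend on `e`. -/
structure IsBranchedCover (f : Hom Y X) : Prop where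
  surj_V : Function.Surjective f.onV
  surj_E : Function.Surjective f.onE
  fibre_equiv : ∀ (w : Y.V) (e₁ e₂ : X.E), X.o e₁ = f.onV w → X.o e₂ = f.onV w →
    Nonempty (f.fibre w e₁ ≃ f.fibre w e₂)

/-- `f_* : Div(Y) → Div(X)`. -/
def pushDiv (f : Hom Y X) : Y.Div →+ X.Div := Div.lift (fun w => X.vertex (f.onV w))

theorem pushDiv_vertex (f : Hom Y X) (w : Y.V) :
    f.pushDiv (Y.vertex w) = X.vertex (f.onV w) := Div.lift_vertex _ _

theorem deg_pushDiv (f : Hom Y X) (D : Y.Div) : X.deg (f.pushDiv D) = Y.deg D := by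
  have : X.deg.comp f.pushDiv = Y.deg := Div.hom_ext (fun v => by
    simp [deg, pushDiv_vertex])
  exact DFunLike.congr_fun this D

/-- `f_* : Div⁰(Y) → Div⁰(X)`. -/
def pushDiv0 (f : Hom Y X) : Y.Div0 →+ X.Div0 :=
  (f.pushDiv.comp Y.Div0.subtype).codRestrict X.Div0 (fun D => by
    have : Y.deg (D : Y.Div) = 0 := D.2
    change X.deg (f.pushDiv D) = 0
    rw [deg_pushDiv, this])


/-- A branched cover maps principal divisors to principal divisors. -/
theorem IsBranchedCover.pushDiv_laplacian_vertex {f : Hom Y X} (hf : f.IsBranchedCover)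
    (w : Y.V) : ∃ m : ℕ,
      f.pushDiv (Y.laplacian (Y.vertex w)) = m • X.laplacian (X.vertex (f.onV w)) := by
  classical
  rcases finite_or_infinite (Y.star w) with hfin | hinf
  swap
  · exact ⟨0, by rw [laplacian_vertex_of_infinite Y w hinf]; simp⟩
  rcases isEmpty_or_nonempty (Y.star w) with hemp | ⟨⟨e₀, he₀⟩⟩
  · refine ⟨0, ?_⟩
    have : Fintype (Y.star w) := Fintype.ofFinite _
    rw [laplacian_vertex_of_finite]
    simp
  have : Fintype (Y.star w) := Fintype.ofFinite _
  have he₀' : Y.o e₀ = w := he₀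
  let g : Y.star w → X.star (f.onV w) := fun e => ⟨f.onE e, by
    have : Y.o e = w := e.2
    change X.o (f.onE e) = _
    rw [f.o_onE, this]⟩
  have eqv : ∀ e' : X.star (f.onV w), {e // g e = e'} ≃ f.fibre w e' := fun e' =>
    { toFun := fun e => ⟨e.1.1, e.1.2, congrArg Subtype.val e.2⟩
      invFun := fun e => ⟨⟨e.1, e.2.1⟩, Subtype.ext e.2.2⟩
      left_inv := fun _ => rfl
      right_inv := fun _ => rfl }
  have hcard : ∀ e', Nat.card {e // g e = e'} = Nat.card {e // g e = g ⟨e₀, he₀⟩} := fun e' => by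
    obtain ⟨q⟩ := hf.fibre_equiv w e' (g ⟨e₀, he₀⟩) e'.2 (g ⟨e₀, he₀⟩).2
    exact Nat.card_congr ((eqv e').trans (q.trans (eqv _).symm))
  have hpos : Nat.card {e // g e = g ⟨e₀, he₀⟩} ≠ 0 := by
    have : Nonempty {e // g e = g ⟨e₀, he₀⟩} := ⟨⟨⟨e₀, he₀⟩, rfl⟩⟩
    exact Nat.card_pos.ne'
  have hsurj : Function.Surjective g := fun e' => by
    have : Nat.card {e // g e = e'} ≠ 0 := by rw [hcard]; exact hpos
    obtain ⟨e⟩ := (Nat.card_ne_zero.mp this).1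
    exact ⟨e.1, e.2⟩
  have : Finite (X.star (f.onV w)) := Finite.of_surjective g hsurj
  have : Fintype (X.star (f.onV w)) := Fintype.ofFinite _
  refine ⟨Nat.card {e // g e = g ⟨e₀, he₀⟩}, ?_⟩
  rw [laplacian_vertex_of_finite, laplacian_vertex_of_finite, map_sum, Finset.smul_sum,
    ← Fintype.sum_fiberwise g]
  refine Finset.sum_congr rfl fun e' _ => ?_
  rw [← hcard e', Nat.card_eq_fintype_card, ← Finset.card_univ, ← Finset.sum_const]
  refine Finset.sum_congr rfl fun e _ => ?_
  have he : f.onE e.1 = e' := congrArg Subtype.val e.2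
  rw [map_sub, pushDiv_vertex, pushDiv_vertex, ← f.t_onE, he]

theorem IsBranchedCover.pushDiv_mem_Pr {f : Hom Y X} (hf : f.IsBranchedCover)
    {D : Y.Div} (hD : D ∈ Y.Pr) : f.pushDiv D ∈ X.Pr := by
  obtain ⟨D, rfl⟩ := hD
  have key : (QuotientAddGroup.mk' X.Pr).comp (f.pushDiv.comp Y.laplacian) = 0 :=
    Div.hom_ext fun w => by
      obtain ⟨m, hm⟩ := hf.pushDiv_laplacian_vertex w
      change QuotientAddGroup.mk' X.Pr (f.pushDiv (Y.laplacian (Y.vertex w))) = 0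
      rw [hm]
      exact (QuotientAddGroup.eq_zero_iff _).mpr
        (X.Pr.nsmul_mem ⟨_, rfl⟩ m)
  exact (QuotientAddGroup.eq_zero_iff _).mp (DFunLike.congr_fun key D)

/-- `f_* : Pic(Y) → Pic(X)` for a branched cover `f`. -/
def IsBranchedCover.pushPic {f : Hom Y X} (hf : f.IsBranchedCover) : Y.Pic →+ X.Pic :=
  QuotientAddGroup.map Y.Pr X.Pr f.pushDiv (fun _ hD => hf.pushDiv_mem_Pr hD)

/-- `f_* : Pic⁰(Y) → Pic⁰(X)` for a branched cover `f`. -/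
def IsBranchedCover.pushPic0 {f : Hom Y X} (hf : f.IsBranchedCover) : Y.Pic0 →+ X.Pic0 :=
  QuotientAddGroup.map (Y.Pr.addSubgroupOf Y.Div0) (X.Pr.addSubgroupOf X.Div0) f.pushDiv0
    (fun _ hD => hf.pushDiv_mem_Pr hD)

end Hom

/-! ### Group actions on graphs -/

/-- An action of a group on a graph by automorphisms. -/
class GraphAction (G : Type*) [Group G] (Y : SerreGraph) where
  actV : MulAction G Y.V
  actE : MulAction G Y.E
  o_smul : ∀ (g : G) (e : Y.E), Y.o (g • e) = g • Y.o e
  t_smul : ∀ (g : G) (e : Y.E), Y.t (g • e) = g • Y.t e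
  inv_smul : ∀ (g : G) (e : Y.E), Y.inv (g • e) = g • Y.inv e

attribute [reducible, instance] GraphAction.actV GraphAction.actE

section Action

variable {G : Type*} [Group G] {Y : SerreGraph} [GraphAction G Y]

instance : DistribMulAction G Y.Div where
  smul g D := Div.lift (fun w => Y.vertex (g • w)) D
  one_smul D := by
    have : Div.lift (fun w => Y.vertex ((1 : G) • w)) = AddMonoidHom.id Y.Div :=
      Div.hom_ext (by simp)
    exact DFunLike.congr_fun this D
  mul_smul g h D := by
    have : Div.lift (fun w => Y.vertex ((g * h) • w)) =
        (Div.lift (fun w => Y.vertex (g • w))).comp (Div.lift (fun w => Y.vertex (h • w))) :=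
      Div.hom_ext (by simp [mul_smul])
    exact DFunLike.congr_fun this D
  smul_zero g := map_zero _
  smul_add g := map_add _

theorem smul_vertex (g : G) (w : Y.V) : g • Y.vertex w = Y.vertex (g • w) :=
  Div.lift_vertex _ _

theorem deg_smul (g : G) (D : Y.Div) : Y.deg (g • D) = Y.deg D := by
  have : Y.deg.comp (DistribSMul.toAddMonoidHom Y.Div g) = Y.deg := Div.hom_ext (fun v => by
    simp [deg, smul_vertex])
  exact DFunLike.congr_fun this D

/-- The bijection `star w → star (g • w)` given by the action of `g`. -/
def starEquiv (g : G) (w : Y.V) : Y.star w ≃ Y.star (g • w) where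
  toFun e := ⟨g • e.1, by
    have : Y.o e = w := e.2
    change Y.o _ = _
    rw [GraphAction.o_smul, this]⟩
  invFun e := ⟨g⁻¹ • e.1, by
    have : Y.o e = g • w := e.2
    change Y.o _ = _
    rw [GraphAction.o_smul, this, inv_smul_smul]⟩
  left_inv e := by simp
  right_inv e := by simp

theorem laplacian_smul (g : G) (D : Y.Div) : Y.laplacian (g • D) = g • Y.laplacian D := by
  have : Y.laplacian.comp (DistribSMul.toAddMonoidHom Y.Div g) =
      (DistribSMul.toAddMonoidHom Y.Div g).comp Y.laplacian := Div.hom_ext (fun w => by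
    change Y.laplacian (g • Y.vertex w) = g • Y.laplacian (Y.vertex w)
    have h1 : Y.val (g • w) = Y.val w := (Nat.card_congr (starEquiv g w)).symm
    have h2 : ∑ᶠ e : Y.star (g • w), Y.vertex (Y.t e) =
        g • ∑ᶠ e : Y.star w, Y.vertex (Y.t e) := by
      rw [← finsum_comp_equiv (starEquiv g w)]
      refine Eq.trans ?_ (AddEquiv.map_finsum (DistribMulAction.toAddEquiv Y.Div g) _).symm
      refine finsum_congr fun e => ?_
      change Y.vertex (Y.t (g • e.1)) = g • Y.vertex (Y.t e)
      rw [GraphAction.t_smul, smul_vertex]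
    rw [smul_vertex, laplacian_vertex, laplacian_vertex, h1, h2, smul_sub, ← smul_vertex,
      ← smul_comm])
  exact DFunLike.congr_fun this D

theorem smul_mem_Pr (g : G) {D : Y.Div} (hD : D ∈ Y.Pr) : g • D ∈ Y.Pr := by
  obtain ⟨D, rfl⟩ := hD
  exact ⟨g • D, laplacian_smul g D⟩

instance : DistribMulAction G Y.Div0 where
  smul g D := ⟨g • (D : Y.Div), (deg_smul g _).trans D.2⟩
  one_smul D := Subtype.ext (one_smul G (D : Y.Div))
  mul_smul g h D := Subtype.ext (mul_smul g h (D : Y.Div))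
  smul_zero g := Subtype.ext (smul_zero g)
  smul_add g D D' := Subtype.ext (smul_add g (D : Y.Div) D')

instance : DistribMulAction G Y.Pic where
  smul g := QuotientAddGroup.map Y.Pr Y.Pr (DistribSMul.toAddMonoidHom Y.Div g)
    (fun _ hD => smul_mem_Pr g hD)
  one_smul x := by
    induction x using QuotientAddGroup.induction_on with | H D =>
    exact congrArg (Pic.mk Y) (one_smul G D)
  mul_smul g h x := by
    induction x using QuotientAddGroup.induction_on with | H D =>
    exact congrArg (Pic.mk Y) (mul_smul g h D)
  smul_zero g := map_zero _
  smul_add g := map_add _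

instance : DistribMulAction G Y.Pic0 where
  smul g := QuotientAddGroup.map (Y.Pr.addSubgroupOf Y.Div0) (Y.Pr.addSubgroupOf Y.Div0)
    (DistribSMul.toAddMonoidHom Y.Div0 g) (fun _ hD => smul_mem_Pr g hD)
  one_smul x := by
    induction x using QuotientAddGroup.induction_on with | H D =>
    exact congrArg (QuotientAddGroup.mk' (Y.Pr.addSubgroupOf Y.Div0)) (one_smul G D)
  mul_smul g h x := by
    induction x using QuotientAddGroup.induction_on with | H D =>
    exact congrArg (QuotientAddGroup.mk' (Y.Pr.addSubgroupOf Y.Div0)) (mul_smul g h D)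
  smul_zero g := map_zero _
  smul_add g := map_add _

end Action

/-! ### Equivariance of push-forward -/

section Equivariance

variable {G H : Type*} [Group G] [Group H] {Y X : SerreGraph} [GraphAction G Y] [GraphAction H X]
  {f : Hom Y X} {φ : G →* H}

theorem Hom.pushDiv_smul (hφ : ∀ (g : G) (w : Y.V), f.onV (g • w) = φ g • f.onV w)
    (g : G) (D : Y.Div) : f.pushDiv (g • D) = φ g • f.pushDiv D := by
  have : f.pushDiv.comp (DistribSMul.toAddMonoidHom Y.Div g) =
      (DistribSMul.toAddMonoidHom X.Div (φ g)).comp f.pushDiv := Div.hom_ext (fun w => by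
    simp [smul_vertex, Hom.pushDiv_vertex, hφ])
  exact DFunLike.congr_fun this D

theorem Hom.IsBranchedCover.pushPic_smul (hf : f.IsBranchedCover)
    (hφ : ∀ (g : G) (w : Y.V), f.onV (g • w) = φ g • f.onV w)
    (g : G) (x : Y.Pic) : hf.pushPic (g • x) = φ g • hf.pushPic x := by
  induction x using QuotientAddGroup.induction_on with | H D =>
  exact congrArg (Pic.mk X) (Hom.pushDiv_smul hφ g D)

theorem Hom.IsBranchedCover.pushPic0_smul (hf : f.IsBranchedCover)
    (hφ : ∀ (g : G) (w : Y.V), f.onV (g • w) = φ g • f.onV w)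
    (g : G) (x : Y.Pic0) : hf.pushPic0 (g • x) = φ g • hf.pushPic0 x := by
  induction x using QuotientAddGroup.induction_on with | H D =>
  exact congrArg (QuotientAddGroup.mk' (X.Pr.addSubgroupOf X.Div0))
    (Subtype.ext (Hom.pushDiv_smul hφ g (D : Y.Div)))

end Equivariance

/-! ### Derived graphs of voltage assignments -/

section Derived

theorem sigma_mk_eq_iff {V G : Type*} [Group G] {I : V → Subgroup G} (v w : V) (σ τ : G) :
    ((⟨v, (σ : G ⧸ I v)⟩ : Σ v : V, G ⧸ I v) = ⟨w, (τ : G ⧸ I w)⟩) ↔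
      v = w ∧ τ⁻¹ * σ ∈ I w := by
  constructor
  · intro h
    obtain ⟨rfl, h2⟩ := Sigma.mk.inj_iff.mp h
    exact ⟨rfl, QuotientGroup.eq.mp (eq_of_heq h2).symm⟩
  · rintro ⟨rfl, h⟩
    rw [QuotientGroup.eq.mpr h]


variable (X : SerreGraph) {G : Type*} [Group G] (α : X.E → G) (hα : ∀ e, α (X.inv e) = (α e)⁻¹)
  (I : X.V → Subgroup G)

/-- The graph `X(G, I, α)`: vertices `(v, σ I_v)`, edges `(e, σ)` from `(o(e), σ I_{o(e)})` to
`(t(e), σ α(e) I_{t(e)})`, with inverse `(ē, σ α(e))`. -/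
def derived : SerreGraph where
  V := Σ v : X.V, G ⧸ I v
  E := X.E × G
  o e := ⟨X.o e.1, (e.2 : G ⧸ I (X.o e.1))⟩
  t e := ⟨X.t e.1, ((e.2 * α e.1 : G) : G ⧸ I (X.t e.1))⟩
  inv e := (X.inv e.1, e.2 * α e.1)
  inv_ne e h := X.inv_ne e.1 (congrArg Prod.fst h)
  inv_inv e := by simp [X.inv_inv, hα]
  o_inv e := (sigma_mk_eq_iff _ _ _ _).mpr ⟨X.o_inv e.1, by simp [one_mem]⟩
  t_inv e := (sigma_mk_eq_iff _ _ _ _).mpr ⟨X.t_inv e.1, by simp [hα, one_mem]⟩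

instance : GraphAction G (X.derived α hα I) where
  actV := inferInstanceAs (MulAction G (Σ v : X.V, G ⧸ I v))
  actE :=
    { smul := fun g e => (e.1, g * e.2)
      one_smul := fun e => Prod.ext rfl (one_mul _)
      mul_smul := fun g h e => Prod.ext rfl (mul_assoc _ _ _) }
  o_smul _ _ := rfl
  t_smul g e := by
    change (⟨X.t e.1, ((g * e.2 * α e.1 : G) : G ⧸ I (X.t e.1))⟩ : Σ v : X.V, G ⧸ I v) =
      ⟨X.t e.1, ((g * (e.2 * α e.1) : G) : G ⧸ I (X.t e.1))⟩
    rw [mul_assoc]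
  inv_smul g e := Prod.ext rfl (mul_assoc _ _ _)

variable {X α I}

variable {H : Type*} [Group H] {β : X.E → H} {hβ : ∀ e, β (X.inv e) = (β e)⁻¹}
  {J : X.V → Subgroup H}

/-- The morphism `X(G, I, α) → X(H, φ(I), φ ∘ α)` induced by a morphism of groups `φ : G → H`,
`(v, σ I_v) ↦ (v, φ(σ) φ(I_v))` and `(e, σ) ↦ (e, φ(σ))`. -/
def derivedMap (hα : ∀ e, α (X.inv e) = (α e)⁻¹) (hβ : ∀ e, β (X.inv e) = (β e)⁻¹) (φ : G →* H) (h1 : ∀ e, φ (α e) = β e)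
    (h2 : ∀ v, (I v).map φ = J v) : Hom (X.derived α hα I) (X.derived β hβ J) where
  onV w := ⟨w.1, Quotient.map' φ (fun a b hab => by
    rw [QuotientGroup.leftRel_apply] at hab ⊢
    rw [← h2, ← map_inv, ← map_mul]
    exact Subgroup.mem_map_of_mem φ hab) w.2⟩
  onE e := (e.1, φ e.2)
  o_onE _ := rfl
  t_onE e := by
    change (⟨X.t e.1, ((φ e.2 * β e.1 : H) : H ⧸ J (X.t e.1))⟩ : Σ v : X.V, H ⧸ J v) =
      ⟨X.t e.1, ((φ (e.2 * α e.1) : H) : H ⧸ J (X.t e.1))⟩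
    rw [map_mul, h1]
  inv_onE e := by
    change (X.inv e.1, φ e.2 * β e.1) = (X.inv e.1, φ (e.2 * α e.1))
    rw [map_mul, h1]

variable {φ : G →* H} {h1 : ∀ e, φ (α e) = β e} {h2 : ∀ v, (I v).map φ = J v}

theorem derivedMap_smul (g : G) (w : (X.derived α hα I).V) :
    (derivedMap hα hβ φ h1 h2).onV (g • w) = φ g • (derivedMap hα hβ φ h1 h2).onV w := by
  obtain ⟨v, q⟩ := w
  induction q using QuotientGroup.induction_on with | H σ =>
  change (⟨v, ((φ (g * σ) : H) : H ⧸ J v)⟩ : Σ v : X.V, H ⧸ J v) =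
    ⟨v, ((φ g * φ σ : H) : H ⧸ J v)⟩
  rw [map_mul]

theorem derivedMap_isBranchedCover (hφ : Function.Surjective φ) :
    (derivedMap hα hβ φ h1 h2).IsBranchedCover where
  surj_V := by
    rintro ⟨v, q⟩
    induction q using QuotientGroup.induction_on with | H τ =>
    obtain ⟨σ, rfl⟩ := hφ τ
    exact ⟨⟨v, (σ : G ⧸ I v)⟩, rfl⟩
  surj_E := by
    rintro ⟨e, τ⟩
    obtain ⟨σ, rfl⟩ := hφ τ
    exact ⟨(e, σ), rfl⟩
  fibre_equiv := by
    rintro ⟨v, q⟩ ⟨e₁, ρ₁⟩ ⟨e₂, ρ₂⟩ he₁ he₂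
    induction q using QuotientGroup.induction_on with | H σ =>
    obtain ⟨a₁, b₁⟩ := (sigma_mk_eq_iff (I := J) (X.o e₁) v ρ₁ (φ σ)).mp he₁
    obtain ⟨a₂, b₂⟩ := (sigma_mk_eq_iff (I := J) (X.o e₂) v ρ₂ (φ σ)).mp he₂
    have hj : ρ₁⁻¹ * ρ₂ ∈ J v := by
      have := (J v).mul_mem ((J v).inv_mem b₁) b₂
      simpa [mul_assoc] using this
    rw [← h2] at hj
    obtain ⟨i, hi, hij⟩ := hj
    have key : ∀ (e : X.E) (ρ : H) (x : X.E × G), X.o e = v →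
        (x ∈ (derivedMap hα hβ φ h1 h2).fibre (⟨v, (σ : G ⧸ I v)⟩ : Σ v : X.V, G ⧸ I v) (e, ρ) ↔
          x.1 = e ∧ σ⁻¹ * x.2 ∈ I v ∧ φ x.2 = ρ) := by
      rintro e ρ ⟨e', τ⟩ he
      constructor
      · rintro ⟨hx1, hx2⟩
        obtain ⟨c1, c2⟩ := (sigma_mk_eq_iff (I := I) (X.o e') v τ σ).mp hx1
        exact ⟨congrArg Prod.fst hx2, c2, congrArg Prod.snd hx2⟩
      · rintro ⟨rfl, c2, rfl⟩
        exact ⟨(sigma_mk_eq_iff (I := I) (X.o e') v τ σ).mpr ⟨he, c2⟩, rfl⟩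
    refine ⟨⟨fun x => ⟨(e₂, x.1.2 * i), (key e₂ ρ₂ _ a₂).mpr ⟨rfl, ?_, ?_⟩⟩,
      fun x => ⟨(e₁, x.1.2 * i⁻¹), (key e₁ ρ₁ _ a₁).mpr ⟨rfl, ?_, ?_⟩⟩, ?_, ?_⟩⟩
    · have := ((key e₁ ρ₁ _ a₁).mp x.2).2.1
      rw [← mul_assoc]
      exact (I v).mul_mem this hi
    · have := ((key e₁ ρ₁ _ a₁).mp x.2).2.2
      rw [map_mul, this, hij, mul_inv_cancel_left]
    · have := ((key e₂ ρ₂ _ a₂).mp x.2).2.1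
      rw [← mul_assoc]
      exact (I v).mul_mem this ((I v).inv_mem hi)
    · have := ((key e₂ ρ₂ _ a₂).mp x.2).2.2
      rw [map_mul, this, map_inv, hij]
      group
    · intro x
      have := ((key e₁ ρ₁ _ a₁).mp x.2).1
      exact Subtype.ext (Prod.ext this.symm (mul_inv_cancel_right _ _))
    · intro x
      have := ((key e₂ ρ₂ _ a₂).mp x.2).1
      exact Subtype.ext (Prod.ext this.symm (inv_mul_cancel_right _ _))

end Derived

end SerreGraph

/-! ## Extension of scalars to the `p`-adic integers -/

section PExt

/-- `M_p = ℤ_p ⊗ M`. The group acting on `M` is recorded in the type. -/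
def PExt (p : ℕ) [Fact p.Prime] (_G : Type*) (M : Type*) [AddCommGroup M] : Type _ :=
  ℤ_[p] ⊗[ℤ] M

/-- `ℤ_p` with the trivial action of a group, which is recorded in the type. -/
def TrivialZp (p : ℕ) [Fact p.Prime] (_G : Type*) : Type := ℤ_[p]

variable (p : ℕ) [Fact p.Prime] (G : Type*) [Group G] (M : Type*) [AddCommGroup M]

namespace PExt

instance : AddCommGroup (PExt p G M) := inferInstanceAs (AddCommGroup (ℤ_[p] ⊗[ℤ] M))

instance : Module ℤ_[p] (PExt p G M) := inferInstanceAs (Module ℤ_[p] (ℤ_[p] ⊗[ℤ] M))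

variable {M}

/-- The pure tensor `a ⊗ m`. -/
def tmul (a : ℤ_[p]) (m : M) : PExt p G M := a ⊗ₜ[ℤ] m

variable {p G}

@[elab_as_elim]
theorem induction {P : PExt p G M → Prop} (h0 : P 0) (h1 : ∀ a m, P (tmul p G a m))
    (h2 : ∀ x y, P x → P y → P (x + y)) (x : PExt p G M) : P x :=
  TensorProduct.induction_on x h0 h1 h2

variable {H : Type*} [Group H] {N : Type*} [AddCommGroup N]

/-- The map `M_p → N_p` induced by an additive map `M → N`. -/
def map (f : M →+ N) : PExt p G M →ₗ[ℤ_[p]] PExt p H N :=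
  TensorProduct.AlgebraTensorModule.map (LinearMap.id (R := ℤ_[p])) f.toIntLinearMap

@[simp] theorem map_tmul (f : M →+ N) (a : ℤ_[p]) (m : M) :
    map (H := H) f (tmul p G a m) = tmul p H a (f m) := rfl

theorem smul_tmul' (a b : ℤ_[p]) (m : M) : a • tmul p G b m = tmul p G (a * b) m := rfl

variable [DistribMulAction G M] [DistribMulAction H N]

variable (p G M) in
/-- The action of `G` on `M_p`, by `ℤ_p`-linear maps. -/
def rep : G →* Module.End ℤ_[p] (PExt p G M) where
  toFun g := map (DistribSMul.toAddMonoidHom M g)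
  map_one' := by
    ext x
    induction x using PExt.induction with
    | h0 => simp
    | h1 a m => simp
    | h2 x y hx hy => rw [_root_.map_add, hx, hy, _root_.map_add]
  map_mul' g h := by
    ext x
    induction x using PExt.induction with
    | h0 => simp
    | h1 a m => simp [mul_smul]
    | h2 x y hx hy => rw [_root_.map_add, hx, hy, _root_.map_add]

/-- `M_p` is a `ℤ_p[G]`-module. -/
instance : Module (MonoidAlgebra ℤ_[p] G) (PExt p G M) :=
  Module.compHom (PExt p G M)
    (MonoidAlgebra.lift ℤ_[p] (Module.End ℤ_[p] (PExt p G M)) G (rep p G M)).toRingHom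

theorem smul_def (a : MonoidAlgebra ℤ_[p] G) (x : PExt p G M) : a • x =
    MonoidAlgebra.lift ℤ_[p] (Module.End ℤ_[p] (PExt p G M)) G (rep p G M) a x := rfl

theorem single_smul_tmul (g : G) (r a : ℤ_[p]) (m : M) :
    (MonoidAlgebra.single g r) • tmul p G a m = tmul p G (r * a) (g • m) := by
  rw [smul_def, MonoidAlgebra.lift_single]
  rfl

/-- An equivariant map induces a semilinear map of the extensions to `ℤ_p`. -/
theorem map_smul_of_equivariant {φ : G →* H} {f : M →+ N}
    (hf : ∀ (g : G) (m : M), f (g • m) = φ g • f m) (a : MonoidAlgebra ℤ_[p] G)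
    (x : PExt p G M) :
    map (H := H) f (a • x) = MonoidAlgebra.mapDomainRingHom ℤ_[p] φ a • map f x := by
  induction a using MonoidAlgebra.induction_linear with
  | zero => simp
  | add a b ha hb => rw [add_smul, map_add, ha, hb, map_add, add_smul]
  | single g r =>
    induction x using PExt.induction with
    | h0 => simp
    | h1 a m =>
      rw [single_smul_tmul, map_tmul, map_tmul, MonoidAlgebra.mapDomainRingHom_apply,
        MonoidAlgebra.mapDomain_single, single_smul_tmul, hf]
    | h2 x y hx hy => rw [smul_add, map_add, hx, hy, map_add, smul_add]

end PExt

instance : AddCommGroup (TrivialZp p G) := inferInstanceAs (AddCommGroup ℤ_[p])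

/-- `ℤ_p[G]` acts on `ℤ_p` through the augmentation `∑ a_g g ↦ ∑ a_g`. -/
instance : Module (MonoidAlgebra ℤ_[p] G) (TrivialZp p G) :=
  Module.compHom ℤ_[p] (MonoidAlgebra.lift ℤ_[p] ℤ_[p] G 1).toRingHom

theorem TrivialZp.single_smul (g : G) (r : ℤ_[p]) (x : TrivialZp p G) :
    MonoidAlgebra.single g r • x = (show TrivialZp p G from r * (show ℤ_[p] from x)) := by
  change (MonoidAlgebra.lift ℤ_[p] ℤ_[p] G 1 (MonoidAlgebra.single g r)) * (show ℤ_[p] from x) = _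
  rw [MonoidAlgebra.lift_single]
  simp

/-- The degree map `s_p : Div_p(Y) → ℤ_p`, `a ⊗ D ↦ s(D) a`, as an additive map. -/
def degAdd (Y : SerreGraph) : PExt p G Y.Div →+ TrivialZp p G :=
  show ℤ_[p] ⊗[ℤ] Y.Div →+ ℤ_[p] from
    ((TensorProduct.AlgebraTensorModule.rid ℤ ℤ_[p] ℤ_[p]).toLinearMap ∘ₗ
      TensorProduct.AlgebraTensorModule.map (LinearMap.id (R := ℤ_[p]) (M := ℤ_[p]))
        Y.deg.toIntLinearMap).toAddMonoidHom

theorem degAdd_tmul (Y : SerreGraph) (a : ℤ_[p]) (D : Y.Div) :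
    degAdd p G Y (PExt.tmul p G a D) = (show TrivialZp p G from Y.deg D • a) := rfl

/-- The degree map `s_p : Div_p(Y) → ℤ_p`, as a map of `ℤ_p[G]`-modules. -/
def degP (Y : SerreGraph) [SerreGraph.GraphAction G Y] :
    PExt p G Y.Div →ₗ[MonoidAlgebra ℤ_[p] G] TrivialZp p G where
  toFun := degAdd p G Y
  map_add' := map_add _
  map_smul' a x := by
    rw [RingHom.id_apply]
    induction a using MonoidAlgebra.induction_linear with
    | zero => simp
    | add a b ha hb => rw [add_smul, map_add, ha, hb, add_smul]
    | single g r =>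
      induction x using PExt.induction with
      | h0 => simp
      | h1 a D =>
        rw [PExt.single_smul_tmul, TrivialZp.single_smul, degAdd_tmul, degAdd_tmul,
          SerreGraph.deg_smul]
        exact (mul_smul_comm (Y.deg D) r a).symm
      | h2 x y hx hy => rw [smul_add, map_add, hx, hy, map_add, smul_add]

end PExt

/-! ## The Iwasawa algebra -/

section IwasawaAlgebra

variable (p : ℕ) [Fact p.Prime] (Γ : Type*) [CommGroup Γ]

/-- `Γ_n = Γ / Γ^(p^n)`. -/
def Gam (p : ℕ) (Γ : Type*) [CommGroup Γ] (n : ℕ) : Type _ :=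
  Γ ⧸ (powMonoidHom (p ^ n) : Γ →* Γ).range

namespace Gam

instance (n : ℕ) : CommGroup (Gam p Γ n) :=
  inferInstanceAs (CommGroup (Γ ⧸ (powMonoidHom (p ^ n) : Γ →* Γ).range))

/-- The projection `Γ → Γ_n`. -/
def proj (n : ℕ) : Γ →* Gam p Γ n := QuotientGroup.mk' _

/-- The projection `Γ_{n+1} → Γ_n`. -/
def trans (n : ℕ) : Gam p Γ (n + 1) →* Gam p Γ n :=
  QuotientGroup.map _ _ (MonoidHom.id Γ) (by
    rintro _ ⟨x, rfl⟩
    exact ⟨x ^ p, by simp [pow_succ', pow_mul]⟩)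

theorem trans_proj (n : ℕ) (g : Γ) : trans p Γ n (proj p Γ (n + 1) g) = proj p Γ n g := rfl

theorem trans_comp_proj (n : ℕ) : (trans p Γ n).comp (proj p Γ (n + 1)) = proj p Γ n := rfl

theorem trans_surjective (n : ℕ) : Function.Surjective (trans p Γ n) := fun x => by
  obtain ⟨g, rfl⟩ := QuotientGroup.mk'_surjective _ x
  exact ⟨proj p Γ (n + 1) g, rfl⟩

end Gam

/-- The compatible sequences in `∏ ℤ_p[Γ_n]`. -/
def iwasawaSubring : Subring (∀ n, MonoidAlgebra ℤ_[p] (Gam p Γ n)) where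
  carrier := {x | ∀ n, MonoidAlgebra.mapDomainRingHom ℤ_[p] (Gam.trans p Γ n) (x (n + 1)) = x n}
  mul_mem' hx hy n := by rw [Pi.mul_apply, map_mul, hx n, hy n, Pi.mul_apply]
  one_mem' n := map_one _
  add_mem' hx hy n := by rw [Pi.add_apply, map_add, hx n, hy n, Pi.add_apply]
  zero_mem' n := map_zero _
  neg_mem' hx n := by rw [Pi.neg_apply, map_neg, hx n, Pi.neg_apply]

/-- The Iwasawa algebra `Λ = lim ℤ_p[Γ_n]`. -/
def IwasawaAlgebra : Type _ := iwasawaSubring p Γ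

instance : CommRing (IwasawaAlgebra p Γ) := inferInstanceAs (CommRing (iwasawaSubring p Γ))

namespace IwasawaAlgebra

/-- The projection `Λ → ℤ_p[Γ_n]`. -/
def ev (n : ℕ) : IwasawaAlgebra p Γ →+* MonoidAlgebra ℤ_[p] (Gam p Γ n) :=
  (Pi.evalRingHom _ n).comp (iwasawaSubring p Γ).subtype

variable {p Γ} in
theorem trans_ev (n : ℕ) (a : IwasawaAlgebra p Γ) :
    MonoidAlgebra.mapDomainRingHom ℤ_[p] (Gam.trans p Γ n) (ev p Γ (n + 1) a) = ev p Γ n a :=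
  a.2 n

/-- The natural map `ℤ_p[Γ] → Λ`. -/
def ofGroupRing : MonoidAlgebra ℤ_[p] Γ →+* IwasawaAlgebra p Γ :=
  (RingHom.pi (fun n => MonoidAlgebra.mapDomainRingHom ℤ_[p] (Gam.proj p Γ n))).codRestrict
    (iwasawaSubring p Γ) (fun a n => by
      change MonoidAlgebra.mapDomainRingHom _ _ (MonoidAlgebra.mapDomainRingHom _ _ a) =
        MonoidAlgebra.mapDomainRingHom _ _ a
      rw [← RingHom.comp_apply, ← MonoidAlgebra.mapDomainRingHom_comp, Gam.trans_comp_proj])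

instance : Algebra (MonoidAlgebra ℤ_[p] Γ) (IwasawaAlgebra p Γ) := (ofGroupRing p Γ).toAlgebra

theorem ev_algebraMap (n : ℕ) (a : MonoidAlgebra ℤ_[p] Γ) :
    ev p Γ n (algebraMap _ _ a) = MonoidAlgebra.mapDomainRingHom ℤ_[p] (Gam.proj p Γ n) a := rfl

variable {Γ}

/-- An element of `Γ`, seen in `Λ`. -/
def of (g : Γ) : IwasawaAlgebra p Γ := algebraMap (MonoidAlgebra ℤ_[p] Γ) _ (MonoidAlgebra.of _ _ g)

/-- `ω_n = γ^(p^n) - 1`. -/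
def omega (γ : Γ) (n : ℕ) : IwasawaAlgebra p Γ := of p (γ ^ p ^ n) - 1

/-- `ω_{n,k} = ω_n / ω_k = ∑_{j < p^(n-k)} (γ^(p^k))^j`, for `k ≤ n`. -/
def omegaQuot (γ : Γ) (n k : ℕ) : IwasawaAlgebra p Γ :=
  ∑ j ∈ Finset.range (p ^ (n - k)), of p ((γ ^ p ^ k) ^ j)

end IwasawaAlgebra

/-! `ℤ_p[Γ_n]`-modules are `Λ`-modules, and `ℤ_p[Γ]`-modules. -/

variable {p Γ} {n : ℕ} {M : Type*} [AddCommGroup M] [DistribMulAction (Gam p Γ n) M]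

instance : Module (IwasawaAlgebra p Γ) (PExt p (Gam p Γ n) M) :=
  Module.compHom _ (IwasawaAlgebra.ev p Γ n)

/-- Here the group ring is that of `Γ`. -/
instance PExt.moduleGroupRing : Module (MonoidAlgebra ℤ_[p] Γ) (PExt p (Gam p Γ n) M) :=
  Module.compHom _ (MonoidAlgebra.mapDomainRingHom ℤ_[p] (Gam.proj p Γ n))

theorem IwasawaAlgebra.smul_eq_ev_smul (a : IwasawaAlgebra p Γ) (x : PExt p (Gam p Γ n) M) :
    a • x = ev p Γ n a • x := rfl

theorem PExt.groupRing_smul_eq (a : MonoidAlgebra ℤ_[p] Γ) (x : PExt p (Gam p Γ n) M) :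
    a • x = MonoidAlgebra.mapDomainRingHom ℤ_[p] (Gam.proj p Γ n) a • x := rfl

instance : IsScalarTower (MonoidAlgebra ℤ_[p] Γ) (IwasawaAlgebra p Γ)
    (PExt p (Gam p Γ n) M) where
  smul_assoc a b x := by
    rw [Algebra.smul_def, mul_smul]
    rfl

end IwasawaAlgebra

/-! ## Towers -/

/-- A graph `X` with a voltage assignment `α` in `Γ` and a subgroup `I_v` for each vertex `v`. -/
structure VoltageDatum (Γ : Type*) [CommGroup Γ] where
  X : SerreGraph.{u, v}
  α : X.E → Γ
  α_inv : ∀ e, α (X.inv e) = (α e)⁻¹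
  I : X.V → Subgroup Γ

namespace VoltageDatum

variable {Γ : Type*} [CommGroup Γ] (T : VoltageDatum Γ) (p : ℕ) [Fact p.Prime]

/-- `X_∞ = X(Γ, I, α)`. -/
def Xinf : SerreGraph := T.X.derived T.α T.α_inv T.I

instance : SerreGraph.GraphAction Γ T.Xinf :=
  inferInstanceAs (SerreGraph.GraphAction Γ (T.X.derived T.α T.α_inv T.I))

theorem proj_α_inv (n : ℕ) (e : T.X.E) :
    Gam.proj p Γ n (T.α (T.X.inv e)) = (Gam.proj p Γ n (T.α e))⁻¹ := by
  rw [T.α_inv, map_inv]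

/-- `X_n = X(Γ_n, I_n, α_n)`, with `α_n` and `I_n` the images of `α` and `I` in `Γ_n`. -/
def level (n : ℕ) : SerreGraph :=
  T.X.derived (fun e => Gam.proj p Γ n (T.α e)) (T.proj_α_inv p n)
    (fun v => (T.I v).map (Gam.proj p Γ n))

instance (n : ℕ) : SerreGraph.GraphAction (Gam p Γ n) (T.level p n) :=
  inferInstanceAs (SerreGraph.GraphAction (Gam p Γ n) (T.X.derived _ (T.proj_α_inv p n) _))

/-- The branched cover `X_∞ → X_n`. -/
def coverInf (n : ℕ) : SerreGraph.Hom T.Xinf (T.level p n) :=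
  SerreGraph.derivedMap T.α_inv (T.proj_α_inv p n) (Gam.proj p Γ n) (fun _ => rfl) (fun _ => rfl)

/-- The branched cover `X_{n+1} → X_n`. -/
def cover (n : ℕ) : SerreGraph.Hom (T.level p (n + 1)) (T.level p n) :=
  SerreGraph.derivedMap (T.proj_α_inv p (n + 1)) (T.proj_α_inv p n) (Gam.trans p Γ n)
    (fun _ => rfl) (fun v => by rw [Subgroup.map_map, Gam.trans_comp_proj])

theorem cover_isBranchedCover (n : ℕ) : (T.cover p n).IsBranchedCover :=
  SerreGraph.derivedMap_isBranchedCover _ (Gam.trans_surjective p Γ n)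

theorem cover_smul (n : ℕ) (g : Gam p Γ (n + 1)) (w : (T.level p (n + 1)).V) :
    (T.cover p n).onV (g • w) = Gam.trans p Γ n g • (T.cover p n).onV w :=
  SerreGraph.derivedMap_smul _ g w

theorem coverInf_smul (n : ℕ) (g : Γ) (w : T.Xinf.V) :
    (T.coverInf p n).onV (g • w) = Gam.proj p Γ n g • (T.coverInf p n).onV w :=
  SerreGraph.derivedMap_smul _ g w

/-! ### The limits of the Picard groups -/

/-- `Div_p(X_n)`, a `Λ`-module. -/
abbrev DivP (n : ℕ) : Type _ := PExt p (Gam p Γ n) (T.level p n).Div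

/-- `Pic_p(X_n) = ℤ_p ⊗ Pic(X_n)`, a `Λ`-module. -/
abbrev PicP (n : ℕ) : Type _ := PExt p (Gam p Γ n) (T.level p n).Pic

/-- `Pic⁰_p(X_n) = ℤ_p ⊗ Pic⁰(X_n)`, a `Λ`-module. -/
abbrev Pic0P (n : ℕ) : Type _ := PExt p (Gam p Γ n) (T.level p n).Pic0

/-- The natural map `Div_p(X_n) → Pic_p(X_n)`. -/
def picMk (n : ℕ) : T.DivP p n →ₗ[ℤ_[p]] T.PicP p n :=
  PExt.map (SerreGraph.Pic.mk (T.level p n))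

/-- The natural map `Pic⁰_p(X_n) → Pic_p(X_n)`. -/
def pic0ToPic (n : ℕ) : T.Pic0P p n →ₗ[ℤ_[p]] T.PicP p n :=
  PExt.map (SerreGraph.Pic0.toPic (T.level p n))

/-- The map `Pic_p(X_{n+1}) → Pic_p(X_n)` induced by the cover. -/
def picTrans (n : ℕ) : T.PicP p (n + 1) →ₗ[ℤ_[p]] T.PicP p n :=
  PExt.map (T.cover_isBranchedCover p n).pushPic

/-- The map `Pic⁰_p(X_{n+1}) → Pic⁰_p(X_n)` induced by the cover. -/
def pic0Trans (n : ℕ) : T.Pic0P p (n + 1) →ₗ[ℤ_[p]] T.Pic0P p n :=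
  PExt.map (T.cover_isBranchedCover p n).pushPic0

theorem picTrans_smul (n : ℕ) (a : IwasawaAlgebra p Γ) (x : T.PicP p (n + 1)) :
    T.picTrans p n (a • x) = a • T.picTrans p n x := by
  rw [IwasawaAlgebra.smul_eq_ev_smul, IwasawaAlgebra.smul_eq_ev_smul, picTrans,
    PExt.map_smul_of_equivariant (φ := Gam.trans p Γ n)
      ((T.cover_isBranchedCover p n).pushPic_smul (T.cover_smul p n)), IwasawaAlgebra.trans_ev]

theorem pic0Trans_smul (n : ℕ) (a : IwasawaAlgebra p Γ) (x : T.Pic0P p (n + 1)) :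
    T.pic0Trans p n (a • x) = a • T.pic0Trans p n x := by
  rw [IwasawaAlgebra.smul_eq_ev_smul, IwasawaAlgebra.smul_eq_ev_smul, pic0Trans,
    PExt.map_smul_of_equivariant (φ := Gam.trans p Γ n)
      ((T.cover_isBranchedCover p n).pushPic0_smul (T.cover_smul p n)), IwasawaAlgebra.trans_ev]

/-- `Pic_Λ = lim Pic_p(X_n)`, the compatible sequences. -/
def PicLambda : Submodule (IwasawaAlgebra p Γ) (∀ n, T.PicP p n) where
  carrier := {x | ∀ n, T.picTrans p n (x (n + 1)) = x n}
  add_mem' hx hy n := by rw [Pi.add_apply, map_add, hx n, hy n, Pi.add_apply]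
  zero_mem' n := map_zero _
  smul_mem' a x hx n := by rw [Pi.smul_apply, picTrans_smul, hx n, Pi.smul_apply]

/-- `Pic⁰_Λ = lim Pic⁰_p(X_n)`, the compatible sequences. -/
def Pic0Lambda : Submodule (IwasawaAlgebra p Γ) (∀ n, T.Pic0P p n) where
  carrier := {x | ∀ n, T.pic0Trans p n (x (n + 1)) = x n}
  add_mem' hx hy n := by rw [Pi.add_apply, map_add, hx n, hy n, Pi.add_apply]
  zero_mem' n := map_zero _
  smul_mem' a x hx n := by rw [Pi.smul_apply, pic0Trans_smul, hx n, Pi.smul_apply]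

/-! ### Divisors with coefficients in the Iwasawa algebra -/

/-- `Div_Λ(X_∞) = Λ ⊗_{ℤ_p[Γ]} Div_p(X_∞)`. -/
def DivLambda : Type _ :=
  IwasawaAlgebra p Γ ⊗[MonoidAlgebra ℤ_[p] Γ] PExt p Γ T.Xinf.Div

instance : AddCommGroup (T.DivLambda p) :=
  inferInstanceAs (AddCommGroup (IwasawaAlgebra p Γ ⊗[MonoidAlgebra ℤ_[p] Γ] PExt p Γ T.Xinf.Div))

instance : Module (IwasawaAlgebra p Γ) (T.DivLambda p) :=
  inferInstanceAs (Module (IwasawaAlgebra p Γ)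
    (IwasawaAlgebra p Γ ⊗[MonoidAlgebra ℤ_[p] Γ] PExt p Γ T.Xinf.Div))

/-- `id ⊗ s_p : Λ ⊗ Div_p(X_∞) → Λ ⊗ ℤ_p`, the tensor products being over `ℤ_p[Γ]`. -/
def degLambda : T.DivLambda p →ₗ[IwasawaAlgebra p Γ]
    IwasawaAlgebra p Γ ⊗[MonoidAlgebra ℤ_[p] Γ] TrivialZp p Γ :=
  (degP p Γ T.Xinf).baseChange (IwasawaAlgebra p Γ)

/-- `Div⁰_Λ(X_∞)`, the kernel of `id ⊗ s_p`. -/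
def Div0Lambda : Submodule (IwasawaAlgebra p Γ) (T.DivLambda p) :=
  LinearMap.ker (T.degLambda p)

/-- `π_n : Div_p(X_∞) → Div_p(X_n)`. -/
def piR (n : ℕ) : PExt p Γ T.Xinf.Div →ₗ[MonoidAlgebra ℤ_[p] Γ] T.DivP p n where
  toFun := PExt.map (T.coverInf p n).pushDiv
  map_add' := map_add _
  map_smul' a x := by
    rw [PExt.map_smul_of_equivariant (φ := Gam.proj p Γ n)
      (SerreGraph.Hom.pushDiv_smul (T.coverInf_smul p n))]
    rfl

/-- `π_n : Div_Λ(X_∞) → Div_p(X_n)`. -/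
def piLambda (n : ℕ) : T.DivLambda p →ₗ[IwasawaAlgebra p Γ] T.DivP p n :=
  (T.piR p n).liftBaseChange (IwasawaAlgebra p Γ)

/-- A divisor on `X_∞`, seen in `Div_Λ(X_∞)`. -/
def toLambda (D : T.Xinf.Div) : T.DivLambda p :=
  1 ⊗ₜ[MonoidAlgebra ℤ_[p] Γ] PExt.tmul p Γ 1 D

/-- The vertex `(v, σ I_v)` of `X_∞`. -/
def vertexInf (v : T.X.V) (σ : Γ) : T.Xinf.V := (⟨v, (σ : Γ ⧸ T.I v)⟩ : Σ v, Γ ⧸ T.I v)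

/-- The divisor `P_v = val_X(v) (v, I_v) - ∑_{o(e) = v} (t(e), α(e) I_{t(e)})`. -/
def P (v : T.X.V) : T.Xinf.Div :=
  T.X.val v • T.Xinf.vertex (T.vertexInf v 1) -
    ∑ᶠ e : T.X.star v, T.Xinf.vertex (T.vertexInf (T.X.t e) (T.α e))

/-- `v` is ramified when `I_v` is non-trivial. -/
def Ramified (v : T.X.V) : Prop := T.I v ≠ ⊥

/-- For a ramified vertex `v`, the integer `k` such that `I_v = Γ^(p^k)`. -/
def ramExp (v : T.X.V) : ℕ := sInf {k | T.I v = (powMonoidHom (p ^ k) : Γ →* Γ).range}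

/-- `Pr_Λ^unr`, generated by the `P_v` with `v` unramified. -/
def PrUnr : Submodule (IwasawaAlgebra p Γ) (T.DivLambda p) :=
  Submodule.span _ {D | ∃ v, ¬ T.Ramified v ∧ D = T.toLambda p (T.P v)}

/-- `Pr_{Λ,n}^ram`, generated by the `ω_{n,k_v} P_v` with `v` ramified and `I_v = Γ^(p^(k_v))`. -/
def PrRam (γ : Γ) (n : ℕ) : Submodule (IwasawaAlgebra p Γ) (T.DivLambda p) :=
  Submodule.span _ {D | ∃ v, T.Ramified v ∧
    D = IwasawaAlgebra.omegaQuot p γ n (T.ramExp p v) • T.toLambda p (T.P v)}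

/-- `N_n = ω_n Div_Λ(X_∞) + Pr_{Λ,n}^ram + Pr_Λ^unr`. -/
def N (γ : Γ) (n : ℕ) : Submodule (IwasawaAlgebra p Γ) (T.DivLambda p) :=
  Ideal.span {IwasawaAlgebra.omega p γ n} • (⊤ : Submodule (IwasawaAlgebra p Γ) (T.DivLambda p)) ⊔
    T.PrRam p γ n ⊔ T.PrUnr p

end VoltageDatum

end

/-!
The module `Div_Λ(X_∞)` is a quotient of the free module `Λ^V` (`ofFree_surjective`), the basis
vector `e_v` mapping to `(v, I_v)`, and all the statements are proved by computing kernels of maps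
out of `Λ^V`.

*Finite level.* The composite `Λ^V → Div_Λ(X_∞) → Pic_p(X_n)` has kernel generated by `ω_n Λ^V`, by
`ω_{k_v} e_v` for `v` ramified (already zero in `Div_Λ(X_∞)`, since `I_v = Γ^(p^(k_v))` fixes the
vertex), and by the lifts of `ω_{n,k_v} P_v` for `v` ramified and of `P_v` for `v` unramified
(`ker_picOfFree`). The last two kinds are relations because the edges of `X_n` at `(v, I_v)` are
indexed by the edges of `X` at `v` and the image of `I_v` in `Γ_n`, which is cyclic generated by
`γ^(p^(k_v))`; so the Laplacian at this vertex is `ω_{n,k_v} P_v` (`laplacian_vertexAt`). There are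
no others because `(v, g I_v) ↦ g e_v` is a well-defined inverse modulo these relations. This uses
that `ω_n` generates the kernel of `Λ → ℤ_p[Γ_n]` (`omega_dvd_of_ev_eq_zero`), which follows from
the compactness of `Λ`.

*Infinite level.* With the topology of coefficientwise convergence, `Λ^V` is compact and its
finitely generated submodules are closed. A point of `lim Pic_p(X_n)` therefore lifts to `Λ^V`, as a
point of an intersection of nested non-empty closed sets (`exists_picOfFree_eq`). The kernel of
`Λ^V → Pic_Λ` is the intersection over `n` of the modules of relations of level `n`; since `ω_n` and
`ω_{n,k}` tend to zero as `n` grows, what is left is generated by the `ω_{k_v} e_v` and the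
unramified `P_v` (`mem_freeUnr_of_forall_mem_freeRel`).

*Degree zero.* Since `ℤ_p` is flat over `ℤ`, `Pic⁰_p(X_n)` is the kernel of the degree on
`Pic_p(X_n)`; and an element of `Div_Λ(X_∞)` lies in `Div⁰_Λ(X_∞)` exactly when its image in
`Pic_p(X_n)`, for any one `n`, has degree zero (`mem_Div0Lambda_iff`). So the statements on degree
zero follow from those on `Pic_p(X_n)` and `Pic_Λ`.
-/

noncomputable section

/-! ### Topologically cyclic pro-`p` groups -/

/-- What the proof uses about a topological generator `γ` of `Γ ≃ ℤ_p`, stated without the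
topology: every element is a power of `γ` times a `p^n`-th power, and the image of `γ` in
`Γ_n = Γ / Γ^(p^n)` has order exactly `p^n`. -/
structure IsProcyclicGenerator (p : ℕ) {Γ : Type*} [CommGroup Γ] (γ : Γ) : Prop where
  exists_pow_mul_pow : ∀ (n : ℕ) (g : Γ), ∃ (a : ℕ) (h : Γ), g = γ ^ a * h ^ p ^ n
  orderOf_proj : ∀ n, orderOf (Gam.proj p Γ n γ) = p ^ n

theorem Gam.proj_surjective {p : ℕ} {Γ : Type*} [CommGroup Γ] (n : ℕ) :
    Function.Surjective (Gam.proj p Γ n) :=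
  QuotientGroup.mk'_surjective _

theorem Gam.proj_eq_one_iff {p : ℕ} {Γ : Type*} [CommGroup Γ] (n : ℕ) (g : Γ) :
    Gam.proj p Γ n g = 1 ↔ ∃ h : Γ, h ^ p ^ n = g :=
  QuotientGroup.eq_one_iff g

theorem Gam.proj_pow_eq_one {p : ℕ} {Γ : Type*} [CommGroup Γ] (n : ℕ) (h : Γ) :
    Gam.proj p Γ n (h ^ p ^ n) = 1 :=
  (Gam.proj_eq_one_iff n _).mpr ⟨h, rfl⟩

section Topological

variable {p : ℕ} [Fact p.Prime] {Γ : Type*} [CommGroup Γ] [TopologicalSpace Γ]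

/-- A topological generator corresponds to a unit of `ℤ_p`: otherwise its powers would all lie in
the closed proper subgroup corresponding to `pℤ_p`. -/
theorem isUnit_of_dense_zpowers (L : Γ ≃ₜ* Multiplicative ℤ_[p]) {γ : Γ}
    (hγ : Dense (Subgroup.zpowers γ : Set Γ)) : IsUnit (L γ).toAdd := by
  by_contra hu
  have hcont : Continuous fun g => (L g).toAdd := continuous_toAdd.comp L.continuous
  have hclosed : IsClosed {g : Γ | ‖(L g).toAdd‖ ≤ (p : ℝ)⁻¹} :=
    isClosed_le (continuous_norm.comp hcont) continuous_const
  have hsub : (Subgroup.zpowers γ : Set Γ) ⊆ {g : Γ | ‖(L g).toAdd‖ ≤ (p : ℝ)⁻¹} := by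
    rintro _ ⟨j, rfl⟩
    have h1 : ‖(L γ).toAdd‖ ≤ (p : ℝ)⁻¹ := by
      rw [PadicInt.isUnit_iff] at hu
      have h2 : ‖(L γ).toAdd‖ < 1 := lt_of_le_of_ne (PadicInt.norm_le_one _) hu
      have := (PadicInt.norm_le_pow_iff_norm_lt_pow_add_one (L γ).toAdd (-1)).mpr (by simpa using h2)
      simpa using this
    simp only [Set.mem_ofPred_eq, map_zpow, toAdd_zpow, zsmul_eq_mul, norm_mul]
    calc _ ≤ 1 * ‖(L γ).toAdd‖ :=
          mul_le_mul_of_nonneg_right (PadicInt.norm_le_one _) (norm_nonneg _)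
      _ ≤ _ := by rwa [one_mul]
  have hall := hclosed.closure_subset_iff.mpr hsub
  rw [hγ.closure_eq] at hall
  have h1 := hall (Set.mem_univ (L.symm (Multiplicative.ofAdd 1)))
  simp only [Set.mem_ofPred_eq, ContinuousMulEquiv.apply_symm_apply, toAdd_ofAdd, norm_one] at h1
  have hp : (1 : ℝ) < p := by exact_mod_cast (Fact.out : p.Prime).one_lt
  exact absurd h1 (not_le.mpr (inv_lt_one_of_one_lt₀ hp))

theorem isProcyclicGenerator_of_dense (L : Γ ≃ₜ* Multiplicative ℤ_[p]) {γ : Γ}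
    (hγ : Dense (Subgroup.zpowers γ : Set Γ)) : IsProcyclicGenerator p γ := by
  obtain ⟨w, hw⟩ := isUnit_of_dense_zpowers L hγ
  have hL : ∀ x y : Γ, (L x).toAdd = (L y).toAdd → x = y := fun x y h =>
    L.injective (Multiplicative.toAdd.injective h)
  have hpow : ∀ (g : Γ) (k : ℕ), (L (g ^ k)).toAdd = k * (L g).toAdd := fun g k => by
    rw [map_pow, toAdd_pow, nsmul_eq_mul]
  refine ⟨fun n g => ?_, fun n => ?_⟩
  · obtain ⟨b, hb⟩ := Ideal.mem_span_singleton'.mp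
      (PadicInt.appr_spec n ((↑w⁻¹ : ℤ_[p]) * (L g).toAdd))
    refine ⟨((↑w⁻¹ : ℤ_[p]) * (L g).toAdd).appr n, L.symm (Multiplicative.ofAdd (w * b)),
      hL _ _ ?_⟩
    rw [map_mul, toAdd_mul, hpow, hpow, ContinuousMulEquiv.apply_symm_apply, toAdd_ofAdd, ← hw]
    have h2 : (w : ℤ_[p]) * ((↑w⁻¹ : ℤ_[p]) * (L g).toAdd) = (L g).toAdd := by
      rw [← mul_assoc, Units.mul_inv, one_mul]
    push_cast
    linear_combination (-1 : ℤ_[p]) * h2 - (w : ℤ_[p]) * hb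
  · have key : ∀ j : ℕ, Gam.proj p Γ n γ ^ j = 1 ↔ p ^ n ∣ j := fun j => by
      rw [← map_pow, Gam.proj_eq_one_iff]
      constructor
      · rintro ⟨h, hh⟩
        have h1 := congrArg (fun x => (L x).toAdd) hh
        simp only [hpow, ← hw] at h1
        have h2 : (j : ℤ_[p]) ∈ Ideal.span {(p : ℤ_[p]) ^ n} := by
          refine Ideal.mem_span_singleton'.mpr ⟨(L h).toAdd * (↑w⁻¹ : ℤ_[p]), ?_⟩
          have h3 : (w : ℤ_[p]) * (↑w⁻¹ : ℤ_[p]) = 1 := Units.mul_inv _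
          push_cast at h1
          linear_combination (↑w⁻¹ : ℤ_[p]) * h1 + (j : ℤ_[p]) * h3
        rw [← PadicInt.ker_toZModPow, RingHom.mem_ker, map_natCast] at h2
        exact (ZMod.natCast_eq_zero_iff j (p ^ n)).mp h2
      · rintro ⟨k, rfl⟩
        exact ⟨γ ^ k, by rw [← pow_mul, mul_comm]⟩
    exact Nat.dvd_antisymm (orderOf_dvd_of_pow_eq_one ((key _).mpr dvd_rfl))
      ((key _).mp (pow_orderOf_eq_one _))

/-- The closed subgroups of `ℤ_p` are its ideals, since `ℕ` is dense in `ℤ_p`. -/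
theorem exists_eq_range_powMonoidHom (L : Γ ≃ₜ* Multiplicative ℤ_[p]) {H : Subgroup Γ}
    (hH : IsClosed (H : Set Γ)) (hne : H ≠ ⊥) :
    ∃ k, H = (powMonoidHom (p ^ k) : Γ →* Γ).range := by
  have hcont : Continuous fun x : ℤ_[p] => L.symm (Multiplicative.ofAdd x) :=
    L.symm.continuous.comp continuous_ofAdd
  let J : Ideal ℤ_[p] :=
    { carrier := {x | L.symm (Multiplicative.ofAdd x) ∈ H}
      add_mem' := fun {x y} hx hy => by
        simpa [ofAdd_add, map_mul] using H.mul_mem hx hy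
      zero_mem' := by simp [one_mem]
      smul_mem' := fun c x hx => by
        have hc : IsClosed {c : ℤ_[p] | L.symm (Multiplicative.ofAdd (c * x)) ∈ H} :=
          hH.preimage (hcont.comp (continuous_mul_const x))
        have hsub : Set.range ((↑) : ℕ → ℤ_[p]) ⊆
            {c : ℤ_[p] | L.symm (Multiplicative.ofAdd (c * x)) ∈ H} := by
          rintro _ ⟨j, rfl⟩
          rw [Set.mem_ofPred_eq, ← nsmul_eq_mul, ofAdd_nsmul, map_pow]
          exact H.pow_mem hx j
        have := hc.closure_subset_iff.mpr hsub
        rw [PadicInt.denseRange_natCast.closure_range] at this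
        exact this (Set.mem_univ c) }
  have hJ : ∀ g : Γ, g ∈ H ↔ (L g).toAdd ∈ J := fun g => by
    change _ ↔ L.symm (Multiplicative.ofAdd (L g).toAdd) ∈ H
    simp
  have hJne : J ≠ ⊥ := fun h => hne <| (Subgroup.eq_bot_iff_forall _).mpr fun g hg => by
    rw [hJ, h, Ideal.mem_bot] at hg
    exact L.injective (by rw [map_one]; exact hg)
  obtain ⟨k, hk⟩ := PadicInt.ideal_eq_span_pow_p hJne
  refine ⟨k, Subgroup.ext fun g => ?_⟩
  rw [hJ, hk, Ideal.mem_span_singleton']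
  constructor
  · rintro ⟨a, ha⟩
    refine ⟨L.symm (Multiplicative.ofAdd a), L.injective (Multiplicative.toAdd.injective ?_)⟩
    rw [powMonoidHom_apply, map_pow, ContinuousMulEquiv.apply_symm_apply, toAdd_pow, toAdd_ofAdd,
      nsmul_eq_mul, ← ha]
    push_cast
    ring
  · rintro ⟨h, rfl⟩
    refine ⟨(L h).toAdd, ?_⟩
    rw [powMonoidHom_apply, map_pow, toAdd_pow, nsmul_eq_mul]
    push_cast
    ring

end Topological

section Levels

variable {p : ℕ} {Γ : Type*} [CommGroup Γ] {γ : Γ}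

theorem IsProcyclicGenerator.exists_proj_eq (hγ : IsProcyclicGenerator p γ) (n : ℕ)
    (x : Gam p Γ n) : ∃ a : ℕ, Gam.proj p Γ n γ ^ a = x := by
  obtain ⟨g, rfl⟩ := Gam.proj_surjective n x
  obtain ⟨a, h, rfl⟩ := hγ.exists_pow_mul_pow n g
  exact ⟨a, by rw [map_mul, Gam.proj_pow_eq_one, mul_one, map_pow]⟩

theorem IsProcyclicGenerator.finite_gam [Fact p.Prime] (hγ : IsProcyclicGenerator p γ) (n : ℕ) :
    Finite (Gam p Γ n) := by
  have hpos : 0 < p ^ n := pow_pos (Fact.out : p.Prime).pos n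
  refine Finite.of_surjective (fun a : Fin (p ^ n) => Gam.proj p Γ n γ ^ (a : ℕ)) fun x => ?_
  obtain ⟨a, rfl⟩ := hγ.exists_proj_eq n x
  refine ⟨⟨a % p ^ n, Nat.mod_lt _ hpos⟩, ?_⟩
  change Gam.proj p Γ n γ ^ (a % p ^ n) = _
  rw [← hγ.orderOf_proj n, pow_mod_orderOf]

/-- The elements of the image of `Γ^(p^k)` in `Γ_n` are the `γ^(p^k j)` with `j < p^(n-k)`, each
listed once; for `k ≥ n` both sides reduce to the neutral element, in accordance with the
truncated subtraction. -/
theorem IsProcyclicGenerator.sum_map_range [Fact p.Prime] (hγ : IsProcyclicGenerator p γ)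
    (n k : ℕ) (S : Subgroup (Gam p Γ n)) [Fintype S]
    (hS : S = (powMonoidHom (p ^ k) : Γ →* Γ).range.map (Gam.proj p Γ n))
    {A : Type*} [AddCommMonoid A] (F : Gam p Γ n → A) :
    ∑ i : S, F i = ∑ j ∈ Finset.range (p ^ (n - k)), F (Gam.proj p Γ n ((γ ^ p ^ k) ^ j)) := by
  have hS' : S = Subgroup.zpowers (Gam.proj p Γ n γ ^ p ^ k) := by
    rw [hS]
    apply le_antisymm
    · rintro _ ⟨_, ⟨h, rfl⟩, rfl⟩
      obtain ⟨a, ha⟩ := hγ.exists_proj_eq n (Gam.proj p Γ n h)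
      refine ⟨a, ?_⟩
      change (Gam.proj p Γ n γ ^ p ^ k) ^ (a : ℤ) = Gam.proj p Γ n (h ^ p ^ k)
      rw [zpow_natCast, map_pow, ← ha, ← pow_mul, ← pow_mul, mul_comm]
    · rw [Subgroup.zpowers_le, ← map_pow]
      exact ⟨_, ⟨γ, rfl⟩, rfl⟩
  have hord : orderOf (Gam.proj p Γ n γ ^ p ^ k) = p ^ (n - k) := by
    have := hγ.finite_gam n
    rw [orderOf_pow, hγ.orderOf_proj]
    have hp := (Fact.out : p.Prime).pos
    rcases le_total n k with h | h
    · rw [Nat.gcd_eq_left (pow_dvd_pow p h), Nat.div_self (pow_pos hp n), Nat.sub_eq_zero_of_le h,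
        pow_zero]
    · rw [Nat.gcd_eq_right (pow_dvd_pow p h), Nat.pow_div h hp]
  subst hS'
  have hfin : IsOfFinOrder (Gam.proj p Γ n γ ^ p ^ k) :=
    orderOf_pos_iff.mp (hord ▸ pow_pos (Fact.out : p.Prime).pos _)
  rw [← hord, ← Fin.sum_univ_eq_sum_range
    (fun j => F (Gam.proj p Γ n ((γ ^ p ^ k) ^ j)))]
  refine (Fintype.sum_equiv (finEquivZPowers hfin) _ _ fun j => ?_).symm
  rw [finEquivZPowers_apply, map_pow, map_pow]

end Levels

/-! ### The topology of the Iwasawa algebra -/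

theorem MonoidAlgebra.coeff_mapDomainRingHom {R G H : Type*} [Semiring R] [Monoid G] [Monoid H]
    [Fintype G] [DecidableEq H] (f : G →* H) (x : MonoidAlgebra R G) (h : H) :
    (MonoidAlgebra.mapDomainRingHom R f x).coeff h = ∑ g, if f g = h then x.coeff g else 0 := by
  classical
  induction x using MonoidAlgebra.induction_linear with
  | zero => simp
  | add x y hx hy =>
    rw [map_add, coeff_add, Finsupp.add_apply, hx, hy, ← Finset.sum_add_distrib]
    refine Finset.sum_congr rfl fun g _ => ?_
    split_ifs <;> simp
  | single g r =>
    rw [mapDomainRingHom_apply, mapDomain_single, coeff_single, coeff_single, Finsupp.single_apply,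
      Finset.sum_eq_single g (fun g' _ hg' => by simp [Ne.symm hg']) (by simp)]
    simp

namespace IwasawaAlgebra

variable {p : ℕ} [Fact p.Prime] {Γ : Type*} [CommGroup Γ]

theorem ext_ev {x y : IwasawaAlgebra p Γ} (h : ∀ n, ev p Γ n x = ev p Γ n y) : x = y :=
  Subtype.ext (funext h)

/-- The coefficients of the components of an element of `Λ = lim ℤ_p[Γ_n]`. -/
def coeffs (x : IwasawaAlgebra p Γ) : ∀ n, Gam p Γ n → ℤ_[p] := fun n g => (ev p Γ n x).coeff g

theorem coeffs_injective : Function.Injective (coeffs (p := p) (Γ := Γ)) := fun _ _ h =>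
  ext_ev fun n => MonoidAlgebra.ext (Finsupp.ext fun g => congrFun (congrFun h n) g)

/-- The topology of coefficientwise `p`-adic convergence. -/
instance : TopologicalSpace (IwasawaAlgebra p Γ) := .induced coeffs inferInstance

theorem continuous_coeffs : Continuous (coeffs (p := p) (Γ := Γ)) := continuous_induced_dom

theorem continuous_coeff (n : ℕ) (g : Gam p Γ n) :
    Continuous fun x : IwasawaAlgebra p Γ => (ev p Γ n x).coeff g :=
  (continuous_apply g).comp ((continuous_apply n).comp continuous_coeffs)

theorem continuous_of_coeff {Z : Type*} [TopologicalSpace Z] {f : Z → IwasawaAlgebra p Γ}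
    (h : ∀ n g, Continuous fun z => (ev p Γ n (f z)).coeff g) : Continuous f :=
  continuous_induced_rng.mpr (continuous_pi fun n => continuous_pi fun g => h n g)

instance : T2Space (IwasawaAlgebra p Γ) :=
  T2Space.of_injective_continuous coeffs_injective continuous_coeffs

instance : IsTopologicalAddGroup (IwasawaAlgebra p Γ) where
  continuous_add := continuous_of_coeff fun n g => by
    simp only [map_add, MonoidAlgebra.coeff_add, Finsupp.add_apply]
    exact ((continuous_coeff n g).comp continuous_fst).add
      ((continuous_coeff n g).comp continuous_snd)
  continuous_neg := continuous_of_coeff fun n g => by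
    simp only [map_neg, MonoidAlgebra.coeff_neg, Finsupp.neg_apply]
    exact (continuous_coeff n g).neg

instance : ContinuousConstSMul (IwasawaAlgebra p Γ) (IwasawaAlgebra p Γ) where
  continuous_const_smul a := continuous_of_coeff fun n g => by
    simp only [smul_eq_mul, map_mul, MonoidAlgebra.coeff_mul_apply_left, Finsupp.sum]
    exact continuous_finsetSum _ fun h _ => continuous_const.mul (continuous_coeff n _)

/-- The sequences of coefficients of elements of `Λ` are cut out by the closed conditions that the
coefficients at level `n` are the sums of those at level `n + 1` along the fibres. -/
theorem isClosed_range_coeffs [∀ n, Finite (Gam p Γ n)] :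
    IsClosed (Set.range (coeffs (p := p) (Γ := Γ))) := by
  classical
  have : ∀ n, Fintype (Gam p Γ n) := fun n => Fintype.ofFinite _
  have hrange : Set.range (coeffs (p := p) (Γ := Γ)) = ⋂ n, ⋂ g : Gam p Γ n,
      {c | (∑ h, if Gam.trans p Γ n h = g then c (n + 1) h else 0) = c n g} := by
    ext c
    simp only [Set.mem_range, Set.mem_iInter, Set.mem_ofPred_eq]
    constructor
    · rintro ⟨x, rfl⟩ n g
      have := congrArg (fun a => a.coeff g) (trans_ev n x)
      rwa [MonoidAlgebra.coeff_mapDomainRingHom] at this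
    · intro hc
      refine ⟨⟨fun n => .ofCoeff (Finsupp.equivFunOnFinite.symm (c n)), fun n => ?_⟩, rfl⟩
      refine MonoidAlgebra.ext (Finsupp.ext fun g => ?_)
      rw [MonoidAlgebra.coeff_mapDomainRingHom]
      exact hc n g
  rw [hrange]
  refine isClosed_iInter fun n => isClosed_iInter fun g => isClosed_eq ?_ ?_
  · refine continuous_finsetSum _ fun h _ => ?_
    split_ifs
    · exact (continuous_apply h).comp (continuous_apply (n + 1))
    · exact continuous_const
  · exact (continuous_apply g).comp (continuous_apply n)

instance [∀ n, Finite (Gam p Γ n)] : CompactSpace (IwasawaAlgebra p Γ) :=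
  Topology.IsClosedEmbedding.compactSpace (f := coeffs (p := p) (Γ := Γ))
    ⟨⟨⟨rfl⟩, coeffs_injective⟩, isClosed_range_coeffs⟩

/-! ### The kernel of the projection to a finite level -/

theorem ev_eq_of_le {x y : IwasawaAlgebra p Γ} {m n : ℕ} (hmn : m ≤ n)
    (h : ev p Γ n x = ev p Γ n y) : ev p Γ m x = ev p Γ m y := by
  induction n, hmn using Nat.le_induction with
  | base => exact h
  | succ n _ ih => exact ih (by rw [← trans_ev, h, trans_ev])

theorem isClosed_setOf_ev_eq (n : ℕ) (x : IwasawaAlgebra p Γ) :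
    IsClosed {y : IwasawaAlgebra p Γ | ev p Γ n y = ev p Γ n x} := by
  have : {y : IwasawaAlgebra p Γ | ev p Γ n y = ev p Γ n x} =
      ⋂ g, {y | (ev p Γ n y).coeff g = (ev p Γ n x).coeff g} := by
    ext y
    simp only [Set.mem_ofPred_eq, Set.mem_iInter]
    exact ⟨fun h g => by rw [h], fun h => MonoidAlgebra.ext (Finsupp.ext h)⟩
  rw [this]
  exact isClosed_iInter fun g => isClosed_eq (continuous_coeff n g) continuous_const

/-- A closed subset of `Λ` contains `x` as soon as, at every high enough level, one of its elements
has the same component as `x`: such elements have a cluster point, by compactness. -/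
theorem mem_of_isClosed [∀ n, Finite (Gam p Γ n)] {s : Set (IwasawaAlgebra p Γ)}
    (hs : IsClosed s) {x : IwasawaAlgebra p Γ} (n₀ : ℕ)
    (h : ∀ n, n₀ ≤ n → ∃ y ∈ s, ev p Γ n y = ev p Γ n x) : x ∈ s := by
  have hcl : ∀ n, IsClosed (s ∩ {y | ev p Γ n y = ev p Γ n x}) := fun n =>
    hs.inter (isClosed_setOf_ev_eq n x)
  obtain ⟨y, hy⟩ := IsCompact.nonempty_iInter_of_sequence_nonempty_isCompact_isClosed
    (fun n => s ∩ {y | ev p Γ n y = ev p Γ n x})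
    (fun n y hy => ⟨hy.1, ev_eq_of_le (Nat.le_succ n) hy.2⟩)
    (fun n => by
      obtain ⟨y, hy, hyx⟩ := h (max n₀ n) (le_max_left _ _)
      exact ⟨y, hy, ev_eq_of_le (le_max_right _ _) hyx⟩)
    (hcl 0).isCompact hcl
  rw [Set.mem_iInter] at hy
  rw [← ext_ev fun n => (hy n).2]
  exact (hy 0).1

theorem isClosed_setOf_dvd [∀ n, Finite (Gam p Γ n)] (a : IwasawaAlgebra p Γ) :
    IsClosed {x : IwasawaAlgebra p Γ | a ∣ x} := by
  have : {x : IwasawaAlgebra p Γ | a ∣ x} = Set.range fun y : IwasawaAlgebra p Γ => a • y :=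
    Set.ext fun x => ⟨fun ⟨y, hy⟩ => ⟨y, hy.symm⟩, fun ⟨y, hy⟩ => ⟨y, hy.symm⟩⟩
  rw [this]
  exact (isCompact_range (continuous_const_smul a)).isClosed

theorem ev_of (n : ℕ) (g : Γ) :
    ev p Γ n (of p g) = MonoidAlgebra.single (Gam.proj p Γ n g) 1 := by
  rw [of, ev_algebraMap, MonoidAlgebra.of_apply, MonoidAlgebra.mapDomainRingHom_apply,
    MonoidAlgebra.mapDomain_single]

theorem of_one : of p (1 : Γ) = 1 := by
  rw [of, map_one, map_one]

theorem of_mul (g h : Γ) : of p (g * h) = of p g * of p h := by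
  rw [of, map_mul, map_mul, of, of]

theorem of_pow (g : Γ) (k : ℕ) : of p (g ^ k) = of p g ^ k := by
  rw [of, map_pow, map_pow, of]

theorem ev_of_eq_one {n : ℕ} {g : Γ} (hg : Gam.proj p Γ n g = 1) : ev p Γ n (of p g) = 1 := by
  rw [ev_of, hg]
  rfl

theorem exists_ev_algebraMap_eq (n : ℕ) (x : IwasawaAlgebra p Γ) :
    ∃ a : MonoidAlgebra ℤ_[p] Γ, ev p Γ n (algebraMap _ _ a) = ev p Γ n x := by
  generalize ev p Γ n x = y
  induction y using MonoidAlgebra.induction_linear with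
  | zero => exact ⟨0, by rw [map_zero, map_zero]⟩
  | add y z hy hz =>
    obtain ⟨a, rfl⟩ := hy
    obtain ⟨b, rfl⟩ := hz
    exact ⟨a + b, by rw [map_add, map_add]⟩
  | single g r =>
    obtain ⟨g, rfl⟩ := Gam.proj_surjective n g
    refine ⟨MonoidAlgebra.single g r, ?_⟩
    rw [ev_algebraMap, MonoidAlgebra.mapDomainRingHom_apply, MonoidAlgebra.mapDomain_single]

variable {γ : Γ}

theorem ev_omega {m n : ℕ} (h : m ≤ n) : ev p Γ m (omega p γ n) = 0 := by
  obtain ⟨k, rfl⟩ := Nat.exists_eq_add_of_le h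
  have : Gam.proj p Γ m (γ ^ p ^ (m + k)) = 1 := by
    rw [pow_add, mul_comm, pow_mul, Gam.proj_pow_eq_one]
  rw [omega, map_sub, ev_of_eq_one this, map_one, sub_self]

/-- At each level `h^(p^n)` is a power of `γ^(p^n)`, so `ω_n` divides it modulo `1`; divisibility
by `ω_n` is a closed condition. -/
theorem omega_dvd_of_pow_sub_one (hγ : IsProcyclicGenerator p γ) (n : ℕ) (h : Γ) :
    omega p γ n ∣ of p (h ^ p ^ n) - 1 := by
  have := hγ.finite_gam
  refine mem_of_isClosed (isClosed_setOf_dvd _) 0 fun m _ => ?_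
  obtain ⟨a, ha⟩ := hγ.exists_proj_eq m (Gam.proj p Γ m h)
  refine ⟨of p ((γ ^ p ^ n) ^ a) - 1, ?_, ?_⟩
  · have := sub_dvd_pow_sub_pow (of p (γ ^ p ^ n)) 1 a
    rwa [one_pow, ← of_pow] at this
  · rw [map_sub, map_sub, ev_of, ev_of, map_pow, map_pow, map_pow, ← ha, ← pow_mul, ← pow_mul,
      mul_comm]

/-- Modulo `ω_n`, the map `Γ → Λ` factors through `Γ_n`, hence so does `ℤ_p[Γ] → Λ/ω_n`. -/
theorem omega_dvd_algebraMap (hγ : IsProcyclicGenerator p γ) {n : ℕ} {a : MonoidAlgebra ℤ_[p] Γ}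
    (ha : MonoidAlgebra.mapDomainRingHom ℤ_[p] (Gam.proj p Γ n) a = 0) :
    omega p γ n ∣ algebraMap _ (IwasawaAlgebra p Γ) a := by
  let Q := IwasawaAlgebra p Γ ⧸ Ideal.span {omega p γ n}
  let q : IwasawaAlgebra p Γ →+* Q := Ideal.Quotient.mk _
  let c : MonoidAlgebra ℤ_[p] Γ →+* Q := q.comp (algebraMap _ _)
  let φ : Γ →* Q := (c : MonoidAlgebra ℤ_[p] Γ →* Q).comp (MonoidAlgebra.of ℤ_[p] Γ)
  let φn : Gam p Γ n →* Q := QuotientGroup.lift _ φ (by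
    rintro _ ⟨h, rfl⟩
    have h1 : q (of p (h ^ p ^ n) - 1) = 0 := Ideal.Quotient.eq_zero_iff_mem.mpr
      (Ideal.mem_span_singleton.mpr (omega_dvd_of_pow_sub_one hγ n h))
    rw [map_sub, map_one, sub_eq_zero] at h1
    exact h1)
  let c₀ : ℤ_[p] →+* Q := c.comp MonoidAlgebra.singleOneRingHom
  let cn : MonoidAlgebra ℤ_[p] (Gam p Γ n) →+* Q :=
    MonoidAlgebra.liftNCRingHom c₀ φn fun _ _ => Commute.all _ _
  have key : cn.comp (MonoidAlgebra.mapDomainRingHom ℤ_[p] (Gam.proj p Γ n)) = c := by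
    refine RingHom.ext fun a => ?_
    induction a using MonoidAlgebra.induction_linear with
    | zero => simp
    | add a b ha hb => rw [map_add, ha, hb, map_add]
    | single g r =>
      rw [RingHom.comp_apply, MonoidAlgebra.mapDomainRingHom_apply, MonoidAlgebra.mapDomain_single]
      change MonoidAlgebra.liftNC (c₀ : ℤ_[p] →+ Q) φn _ = _
      rw [MonoidAlgebra.liftNC_single]
      change c (MonoidAlgebra.single 1 r) * c (MonoidAlgebra.single g 1) = _
      rw [← map_mul, MonoidAlgebra.single_mul_single, one_mul, mul_one]
  rw [← Ideal.mem_span_singleton, ← Ideal.Quotient.eq_zero_iff_mem]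
  change c a = 0
  rw [← key, RingHom.comp_apply, ha, map_zero]

/-- The kernel of `Λ → ℤ_p[Γ_n]` is generated by `ω_n`. -/
theorem omega_dvd_of_ev_eq_zero (hγ : IsProcyclicGenerator p γ) {n : ℕ} {x : IwasawaAlgebra p Γ}
    (hx : ev p Γ n x = 0) : omega p γ n ∣ x := by
  have := hγ.finite_gam
  refine mem_of_isClosed (isClosed_setOf_dvd _) n fun m hm => ?_
  obtain ⟨a, ha⟩ := exists_ev_algebraMap_eq m x
  refine ⟨algebraMap _ _ a, omega_dvd_algebraMap hγ ?_, ha⟩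
  rw [← ev_algebraMap, ev_eq_of_le hm ha, hx]

/-- `Λ` is the sum of the image of `ℤ_p[Γ]` and of `ω_n Λ`. -/
theorem exists_eq_algebraMap_add (hγ : IsProcyclicGenerator p γ) (n : ℕ)
    (x : IwasawaAlgebra p Γ) :
    ∃ (a : MonoidAlgebra ℤ_[p] Γ) (y : IwasawaAlgebra p Γ),
      x = algebraMap _ _ a + omega p γ n * y := by
  obtain ⟨a, ha⟩ := exists_ev_algebraMap_eq n x
  obtain ⟨y, hy⟩ := omega_dvd_of_ev_eq_zero hγ (n := n) (x := x - algebraMap _ _ a) (by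
    rw [map_sub, ha, sub_self])
  exact ⟨a, y, by rw [← hy, add_sub_cancel]⟩

theorem omegaQuot_self (n : ℕ) : omegaQuot p γ n n = 1 := by
  simp [omegaQuot, of_one]

/-- The component of `ω_{n,k}` at a fixed level `m` is highly divisible by `p` for large `n`: it is
a sum over `p^(n-k-m)` periods of the powers of an element of order dividing `p^m`. -/
theorem pow_dvd_ev_omegaQuot {m j k n : ℕ} (h : k + m + j ≤ n) :
    (p : MonoidAlgebra ℤ_[p] (Gam p Γ m)) ^ j ∣ ev p Γ m (omegaQuot p γ n k) := by
  obtain ⟨i, rfl⟩ := Nat.exists_eq_add_of_le h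
  have hexp : k + m + j + i - k = m + (j + i) := by omega
  set x := ev p Γ m (of p (γ ^ p ^ k)) with hx
  have hx1 : x ^ p ^ m = 1 := by
    rw [hx, ← map_pow, ← of_pow, ev_of_eq_one (Gam.proj_pow_eq_one _ _)]
  have hsum : ∀ N : ℕ, ∑ a ∈ Finset.range (p ^ m * N), x ^ a =
      N * ∑ a ∈ Finset.range (p ^ m), x ^ a := fun N => by
    induction N with
    | zero => simp
    | succ N ih =>
      rw [mul_add, mul_one, Finset.sum_range_add, ih]
      simp only [pow_add, pow_mul, hx1, one_pow, one_mul]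
      push_cast
      ring
  have : ev p Γ m (omegaQuot p γ (k + m + j + i) k) = ∑ a ∈ Finset.range (p ^ m * p ^ (j + i)),
      x ^ a := by
    rw [omegaQuot, map_sum, hexp, pow_add p m]
    simp only [of_pow _ (_ : ℕ), map_pow, hx]
  rw [this, hsum, pow_add]
  push_cast
  rw [mul_assoc]
  exact dvd_mul_right _ _

end IwasawaAlgebra

/-! ### Scalar extensions as modules over the Iwasawa algebra -/

namespace IwasawaAlgebra

variable (p : ℕ) [Fact p.Prime] (Γ : Type*) [CommGroup Γ]

/-- The constants `ℤ_p → Λ`. -/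
def const : ℤ_[p] →+* IwasawaAlgebra p Γ :=
  (algebraMap (MonoidAlgebra ℤ_[p] Γ) _).comp MonoidAlgebra.singleOneRingHom

variable {p Γ}

theorem algebraMap_single (g : Γ) (r : ℤ_[p]) :
    algebraMap (MonoidAlgebra ℤ_[p] Γ) (IwasawaAlgebra p Γ) (MonoidAlgebra.single g r) =
      const p Γ r * of p g := by
  change _ = algebraMap (MonoidAlgebra ℤ_[p] Γ) (IwasawaAlgebra p Γ) (MonoidAlgebra.single 1 r) *
    algebraMap (MonoidAlgebra ℤ_[p] Γ) (IwasawaAlgebra p Γ) (MonoidAlgebra.single g 1)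
  rw [← map_mul, MonoidAlgebra.single_mul_single, one_mul, mul_one]

end IwasawaAlgebra

namespace PExt

open IwasawaAlgebra

variable {p : ℕ} [Fact p.Prime] {Γ : Type*} [CommGroup Γ] {n : ℕ}
  {M N : Type*} [AddCommGroup M] [AddCommGroup N]
  [DistribMulAction (Gam p Γ n) M] [DistribMulAction (Gam p Γ n) N]

theorem const_mul_of_smul_tmul (r : ℤ_[p]) (g : Γ) (a : ℤ_[p]) (m : M) :
    (const p Γ r * of p g) • tmul p (Gam p Γ n) a m =
      tmul p (Gam p Γ n) (r * a) (Gam.proj p Γ n g • m) := by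
  rw [← algebraMap_single, smul_eq_ev_smul, ev_algebraMap, MonoidAlgebra.mapDomainRingHom_apply,
    MonoidAlgebra.mapDomain_single, single_smul_tmul]

/-- The `Λ`-linear map `M_p → N_p` induced by a `Γ_n`-equivariant map `M → N`. -/
def mapLambda (f : M →+ N) (hf : ∀ (g : Gam p Γ n) (m : M), f (g • m) = g • f m) :
    PExt p (Gam p Γ n) M →ₗ[IwasawaAlgebra p Γ] PExt p (Gam p Γ n) N where
  toFun := map f
  map_add' := map_add _
  map_smul' a x := by
    rw [smul_eq_ev_smul, map_smul_of_equivariant (φ := MonoidHom.id _) hf,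
      MonoidAlgebra.mapDomainRingHom_id]
    rfl

end PExt

namespace VoltageDatum

open IwasawaAlgebra

variable {p : ℕ} [Fact p.Prime] {Γ : Type*} [CommGroup Γ] {γ : Γ} (T : VoltageDatum.{u, v} Γ)

variable (p) in
/-- The `Λ`-linear map `Div_p(X_n) → Pic_p(X_n)`. -/
def picMkLambda (n : ℕ) : T.DivP p n →ₗ[IwasawaAlgebra p Γ] T.PicP p n :=
  PExt.mapLambda (SerreGraph.Pic.mk (T.level p n)) fun _ _ => rfl

/-! ### The presentation of `Div_Λ(X_∞)` by a free module -/

variable (p) in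
/-- The map `Div(X_∞) → Div_Λ(X_∞)`, as an additive map. -/
def toLambdaHom : T.Xinf.Div →+ T.DivLambda p where
  toFun := T.toLambda p
  map_zero' := by
    have : PExt.tmul p Γ 1 (0 : T.Xinf.Div) = 0 := TensorProduct.tmul_zero _ _
    rw [toLambda, this]
    exact TensorProduct.tmul_zero _ _
  map_add' D D' := by
    have : PExt.tmul p Γ 1 (D + D') = PExt.tmul p Γ 1 D + PExt.tmul p Γ 1 D' :=
      TensorProduct.tmul_add _ _ _
    rw [toLambda, this]
    exact TensorProduct.tmul_add _ _ _

theorem toLambdaHom_apply (D : T.Xinf.Div) : T.toLambdaHom p D = T.toLambda p D := rfl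

theorem tmul_tmul_eq_smul_toLambda (a : IwasawaAlgebra p Γ) (b : ℤ_[p]) (D : T.Xinf.Div) :
    (a ⊗ₜ[MonoidAlgebra ℤ_[p] Γ] PExt.tmul p Γ b D : T.DivLambda p) =
      (a * const p Γ b) • T.toLambda p D := by
  have h1 : PExt.tmul p Γ b D =
      (MonoidAlgebra.single (1 : Γ) b : MonoidAlgebra ℤ_[p] Γ) • PExt.tmul p Γ 1 D := by
    rw [PExt.single_smul_tmul, mul_one, one_smul]
  rw [h1]
  refine (TensorProduct.smul_tmul _ _ _).symm.trans ?_
  change _ = ((a * const p Γ b) * 1) ⊗ₜ[MonoidAlgebra ℤ_[p] Γ] PExt.tmul p Γ 1 D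
  rw [Algebra.smul_def, mul_comm, mul_one]
  rfl

theorem smul_vertexInf (v : T.X.V) (g h : Γ) : g • T.vertexInf v h = T.vertexInf v (g * h) := rfl

theorem toLambda_smul (g : Γ) (D : T.Xinf.Div) : T.toLambda p (g • D) = of p g • T.toLambda p D := by
  have h1 : PExt.tmul p Γ 1 (g • D) =
      (MonoidAlgebra.single g 1 : MonoidAlgebra ℤ_[p] Γ) • PExt.tmul p Γ 1 D := by
    rw [PExt.single_smul_tmul, mul_one]
  rw [toLambda, h1]
  refine (TensorProduct.smul_tmul _ _ _).symm.trans ?_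
  change _ = (of p g * 1) ⊗ₜ[MonoidAlgebra ℤ_[p] Γ] PExt.tmul p Γ 1 D
  rw [Algebra.smul_def]
  rfl

theorem toLambda_vertexInf (v : T.X.V) (g : Γ) :
    T.toLambda p (T.Xinf.vertex (T.vertexInf v g)) =
      of p g • T.toLambda p (T.Xinf.vertex (T.vertexInf v 1)) := by
  rw [← toLambda_smul, SerreGraph.smul_vertex, smul_vertexInf, mul_one]

section Presentation

variable [Fintype T.X.V] [DecidableEq T.X.V]

variable (p) in
/-- The surjection `Λ^V → Div_Λ(X_∞)` mapping the basis vector at `v` to the vertex `(v, I_v)`. -/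
def ofFree : (T.X.V → IwasawaAlgebra p Γ) →ₗ[IwasawaAlgebra p Γ] T.DivLambda p :=
  Fintype.linearCombination (IwasawaAlgebra p Γ)
    fun v => T.toLambda p (T.Xinf.vertex (T.vertexInf v 1))

theorem ofFree_single (v : T.X.V) (a : IwasawaAlgebra p Γ) :
    T.ofFree p (Pi.single v a) = a • T.toLambda p (T.Xinf.vertex (T.vertexInf v 1)) :=
  Fintype.linearCombination_apply_single _ _ _ _

theorem ofFree_single_of (v : T.X.V) (g : Γ) :
    T.ofFree p (Pi.single v (of p g)) = T.toLambda p (T.Xinf.vertex (T.vertexInf v g)) := by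
  rw [ofFree_single, ← toLambda_vertexInf]

theorem ofFree_surjective : Function.Surjective (T.ofFree p) := by
  rw [← LinearMap.range_eq_top, eq_top_iff]
  rintro x -
  have hD : ∀ D : T.Xinf.Div, T.toLambda p D ∈ LinearMap.range (T.ofFree p) := by
    intro D
    have : ((LinearMap.range (T.ofFree p)).mkQ.toAddMonoidHom.comp (T.toLambdaHom p)) = 0 := by
      refine SerreGraph.Div.hom_ext ?_
      rintro ⟨v, q⟩
      induction q using QuotientGroup.induction_on with | H g =>
      exact (Submodule.Quotient.mk_eq_zero _).mpr ⟨_, T.ofFree_single_of v g⟩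
    exact (Submodule.Quotient.mk_eq_zero _).mp (DFunLike.congr_fun this D)
  refine TensorProduct.induction_on x (zero_mem _) (fun a y => ?_) fun _ _ => add_mem
  induction y using PExt.induction with
  | h0 => rw [TensorProduct.tmul_zero]; exact zero_mem _
  | h1 b D =>
    rw [tmul_tmul_eq_smul_toLambda]
    exact Submodule.smul_mem _ _ (hD D)
  | h2 y z hy hz => rw [TensorProduct.tmul_add]; exact add_mem hy hz

variable [∀ v, Fintype (T.X.star v)]

variable (p) in
/-- The lift of `P_v` to `Λ^V`. -/
def freeP (v : T.X.V) : T.X.V → IwasawaAlgebra p Γ :=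
  ∑ e : T.X.star v, (Pi.single v 1 - Pi.single (T.X.t e) (of p (T.α e)))

omit [Fintype T.X.V] [DecidableEq T.X.V] in
theorem P_eq_sum (v : T.X.V) : T.P v = ∑ e : T.X.star v,
    (T.Xinf.vertex (T.vertexInf v 1) - T.Xinf.vertex (T.vertexInf (T.X.t e) (T.α e))) := by
  rw [P, finsum_eq_sum_of_fintype, Finset.sum_sub_distrib, SerreGraph.val,
    Nat.card_eq_fintype_card]
  simp

theorem ofFree_freeP (v : T.X.V) : T.ofFree p (T.freeP p v) = T.toLambda p (T.P v) := by
  rw [freeP, P_eq_sum, ← toLambdaHom_apply, map_sum, map_sum]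
  refine Finset.sum_congr rfl fun e _ => ?_
  rw [map_sub, map_sub, ofFree_single_of, ← of_one, ofFree_single_of]
  rfl

/-- The module of relations of `Div_Λ(X_∞) / Pr_Λ^unr` as a quotient of `Λ^V`: the relation
`ω_k e_v` expresses that `I_v = Γ^(p^k)` fixes the vertex `(v, I_v)`. -/
def freeUnr (γ : Γ) : Submodule (IwasawaAlgebra p Γ) (T.X.V → IwasawaAlgebra p Γ) :=
  Submodule.span _ {f | ∃ v, T.Ramified v ∧ f = Pi.single v (omega p γ (T.ramExp p v))} ⊔
    Submodule.span _ {f | ∃ v, ¬ T.Ramified v ∧ f = T.freeP p v}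

/-- The lift to `Λ^V` of the part `ω_n Div_Λ(X_∞) + Pr_{Λ,n}^ram` of `N_n`. -/
def freeRam (γ : Γ) (n : ℕ) : Submodule (IwasawaAlgebra p Γ) (T.X.V → IwasawaAlgebra p Γ) :=
  Ideal.span {omega p γ n} •
      (⊤ : Submodule (IwasawaAlgebra p Γ) (T.X.V → IwasawaAlgebra p Γ)) ⊔
    Submodule.span _ {f | ∃ v, T.Ramified v ∧ f = omegaQuot p γ n (T.ramExp p v) • T.freeP p v}

omit [∀ v, Fintype (T.X.star v)] in
theorem ofFree_single_omega {v : T.X.V} {k : ℕ}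
    (hv : T.I v = (powMonoidHom (p ^ k) : Γ →* Γ).range) :
    T.ofFree p (Pi.single v (omega p γ k)) = 0 := by
  have h : T.vertexInf v (γ ^ p ^ k) = T.vertexInf v 1 :=
    (SerreGraph.sigma_mk_eq_iff v v _ _).mpr ⟨rfl, by
      rw [inv_one, one_mul, hv]
      exact ⟨γ, rfl⟩⟩
  rw [omega, Pi.single_sub, map_sub, ofFree_single_of, h, ← of_one, ofFree_single_of, sub_self]

theorem map_ofFree_freeUnr
    (hI : ∀ v, T.Ramified v → T.I v = (powMonoidHom (p ^ T.ramExp p v) : Γ →* Γ).range) :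
    (T.freeUnr γ).map (T.ofFree p) = T.PrUnr p := by
  have h1 : (Submodule.span (IwasawaAlgebra p Γ) {f : T.X.V → IwasawaAlgebra p Γ |
      ∃ v, T.Ramified v ∧ f = Pi.single v (omega p γ (T.ramExp p v))}).map (T.ofFree p) = ⊥ := by
    rw [Submodule.map_span, Submodule.span_eq_bot]
    rintro _ ⟨_, ⟨v, hv, rfl⟩, rfl⟩
    exact T.ofFree_single_omega (hI v hv)
  rw [freeUnr, Submodule.map_sup, h1, bot_sup_eq, Submodule.map_span, PrUnr]
  congr 1
  ext D
  constructor
  · rintro ⟨_, ⟨v, hv, rfl⟩, rfl⟩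
    exact ⟨v, hv, T.ofFree_freeP v⟩
  · rintro ⟨v, hv, rfl⟩
    exact ⟨_, ⟨v, hv, rfl⟩, T.ofFree_freeP v⟩

theorem map_ofFree_sup
    (hI : ∀ v, T.Ramified v → T.I v = (powMonoidHom (p ^ T.ramExp p v) : Γ →* Γ).range) (n : ℕ) :
    (T.freeUnr γ ⊔ T.freeRam γ n).map (T.ofFree p) = T.N p γ n := by
  rw [Submodule.map_sup, T.map_ofFree_freeUnr hI, freeRam, Submodule.map_sup,
    Submodule.map_smul'', Submodule.map_top, LinearMap.range_eq_top.mpr T.ofFree_surjective,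
    Submodule.map_span, N, sup_comm]
  congr 2
  rw [PrRam]
  congr 1
  ext D
  constructor
  · rintro ⟨_, ⟨v, hv, rfl⟩, rfl⟩
    exact ⟨v, hv, by rw [map_smul, T.ofFree_freeP v]⟩
  · rintro ⟨v, hv, rfl⟩
    exact ⟨_, ⟨v, hv, rfl⟩, by rw [map_smul, T.ofFree_freeP v]⟩

end Presentation

end VoltageDatum

/-! ### The Laplacian at a finite level -/

namespace VoltageDatum

open IwasawaAlgebra

variable {p : ℕ} [Fact p.Prime] {Γ : Type*} [CommGroup Γ] {γ : Γ} (T : VoltageDatum.{u, v} Γ)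

variable (p) in
/-- The vertex `(v, g I_v)` of `X_n`, for `g` in `Γ`. -/
def vertexAt (n : ℕ) (v : T.X.V) (g : Γ) : (T.level p n).V :=
  (⟨v, (Gam.proj p Γ n g : Gam p Γ n ⧸ (T.I v).map (Gam.proj p Γ n))⟩ :
    Σ v, Gam p Γ n ⧸ (T.I v).map (Gam.proj p Γ n))

theorem exists_vertexAt_eq (n : ℕ) (w : (T.level p n).V) : ∃ v g, w = T.vertexAt p n v g := by
  obtain ⟨v, q⟩ := w
  induction q using QuotientGroup.induction_on with | H σ =>
  obtain ⟨g, rfl⟩ := Gam.proj_surjective n σ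
  exact ⟨v, g, rfl⟩

/-- Two lifts to `Γ` of a vertex of `X_n` differ by an element of `I_v Γ^(p^n)`. -/
theorem vertexAt_eq_iff (n : ℕ) (v w : T.X.V) (g h : Γ) :
    T.vertexAt p n v g = T.vertexAt p n w h ↔
      v = w ∧ ∃ i ∈ T.I w, ∃ x : Γ, g = h * i * x ^ p ^ n := by
  refine (SerreGraph.sigma_mk_eq_iff (I := fun v => (T.I v).map (Gam.proj p Γ n)) v w _ _).trans
    (and_congr_right fun _ => ?_)
  constructor
  · rintro ⟨i, hi, hig⟩
    rw [← map_inv, ← map_mul] at hig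
    obtain ⟨x, hx⟩ := (Gam.proj_eq_one_iff n (i⁻¹ * (h⁻¹ * g))).mp (by
      rw [map_mul, map_inv, hig, inv_mul_cancel])
    exact ⟨i, hi, x, by rw [hx]; group⟩
  · rintro ⟨i, hi, x, rfl⟩
    refine ⟨i, hi, ?_⟩
    rw [map_mul, map_mul, Gam.proj_pow_eq_one]
    group

variable (p) in
open Classical in
/-- The exponent `k` such that the image of `I_v` in `Γ_n` is that of `Γ^(p^k)`, both for ramified
and for unramified `v`. -/
def levelExp (n : ℕ) (v : T.X.V) : ℕ := if T.Ramified v then T.ramExp p v else n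

omit [Fact p.Prime] in
theorem map_proj_I
    (hI : ∀ v, T.Ramified v → T.I v = (powMonoidHom (p ^ T.ramExp p v) : Γ →* Γ).range)
    (n : ℕ) (v : T.X.V) : (T.I v).map (Gam.proj p Γ n) =
      (powMonoidHom (p ^ T.levelExp p n v) : Γ →* Γ).range.map (Gam.proj p Γ n) := by
  by_cases hv : T.Ramified v
  · rw [levelExp, if_pos hv, ← hI v hv]
  · rw [levelExp, if_neg hv, not_not.mp hv, Subgroup.map_bot]
    refine ((Subgroup.eq_bot_iff_forall _).mpr ?_).symm
    rintro _ ⟨_, ⟨h, rfl⟩, rfl⟩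
    exact Gam.proj_pow_eq_one n h

variable (p) in
/-- The edges of `X_n` at `(v, g I_v)` are the `(e, g i)` with `o(e) = v` and `i` in the image of
`I_v`. -/
def starLevelEquiv (n : ℕ) (v : T.X.V) (g : Γ) :
    T.X.star v × (T.I v).map (Gam.proj p Γ n) ≃ (T.level p n).star (T.vertexAt p n v g) where
  toFun x := ⟨(x.1.1, Gam.proj p Γ n g * x.2.1),
    (SerreGraph.sigma_mk_eq_iff (I := fun v => (T.I v).map (Gam.proj p Γ n)) _ _ _ _).mpr
      ⟨x.1.2, by rw [inv_mul_cancel_left]; exact x.2.2⟩⟩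
  invFun e := ⟨⟨e.1.1, ((SerreGraph.sigma_mk_eq_iff
      (I := fun v => (T.I v).map (Gam.proj p Γ n)) _ _ _ _).mp e.2).1⟩,
    ⟨(Gam.proj p Γ n g)⁻¹ * e.1.2, ((SerreGraph.sigma_mk_eq_iff
      (I := fun v => (T.I v).map (Gam.proj p Γ n)) _ _ _ _).mp e.2).2⟩⟩
  left_inv x := Prod.ext rfl (Subtype.ext (inv_mul_cancel_left _ _))
  right_inv e := Subtype.ext (Prod.ext rfl (mul_inv_cancel_left _ _))

theorem t_starLevelEquiv (n : ℕ) (v : T.X.V) (g i : Γ) (e : T.X.star v)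
    (hi : Gam.proj p Γ n i ∈ (T.I v).map (Gam.proj p Γ n)) :
    (T.level p n).t (T.starLevelEquiv p n v g (e, ⟨Gam.proj p Γ n i, hi⟩)) =
      T.vertexAt p n (T.X.t e) (g * i * T.α e) := by
  change _ = (⟨T.X.t e, (Gam.proj p Γ n (g * i * T.α e) : Gam p Γ n ⧸ _)⟩ :
    Σ v, Gam p Γ n ⧸ (T.I v).map (Gam.proj p Γ n))
  rw [map_mul, map_mul]
  rfl

variable [∀ v, Fintype (T.X.star v)]

/-- The Laplacian of `X_n` is the push-forward of `ω_{n,k} P_v`, since the image of `I_v` in `Γ_n`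
consists of the powers of `γ^(p^k)`. -/
theorem laplacian_vertexAt (hγ : IsProcyclicGenerator p γ)
    (hI : ∀ v, T.Ramified v → T.I v = (powMonoidHom (p ^ T.ramExp p v) : Γ →* Γ).range)
    (n : ℕ) (v : T.X.V) (g : Γ) :
    (T.level p n).laplacian ((T.level p n).vertex (T.vertexAt p n v g)) =
      ∑ e : T.X.star v, ∑ j ∈ Finset.range (p ^ (n - T.levelExp p n v)),
        ((T.level p n).vertex (T.vertexAt p n v (g * (γ ^ p ^ T.levelExp p n v) ^ j)) -
          (T.level p n).vertex
            (T.vertexAt p n (T.X.t e) (g * (γ ^ p ^ T.levelExp p n v) ^ j * T.α e))) := by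
  have := hγ.finite_gam n
  have : Fintype ((T.I v).map (Gam.proj p Γ n)) := Fintype.ofFinite _
  have : Fintype ((T.level p n).star (T.vertexAt p n v g)) :=
    Fintype.ofEquiv _ (T.starLevelEquiv p n v g)
  rw [SerreGraph.laplacian_vertex_of_finite,
    ← Fintype.sum_equiv (T.starLevelEquiv p n v g) _ _ fun _ => rfl, Fintype.sum_prod_type]
  refine Finset.sum_congr rfl fun e _ => ?_
  -- The summand as a function of an arbitrary element of `Γ_n`, written through a section of
  -- `Γ → Γ_n`.
  let s : Gam p Γ n → Γ := Function.surjInv (Gam.proj_surjective n)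
  have hs : ∀ x, Gam.proj p Γ n (s x) = x := Function.surjInv_eq (Gam.proj_surjective n)
  let F : Gam p Γ n → (T.level p n).Div := fun x =>
    (T.level p n).vertex (T.vertexAt p n v g) -
      (T.level p n).vertex (T.vertexAt p n (T.X.t e) (g * s x * T.α e))
  have hF : ∀ i : (T.I v).map (Gam.proj p Γ n),
      (T.level p n).vertex (T.vertexAt p n v g) -
        (T.level p n).vertex ((T.level p n).t (T.starLevelEquiv p n v g (e, i))) = F i := by
    rintro ⟨i, hi⟩
    have hi' : Gam.proj p Γ n (s i) ∈ (T.I v).map (Gam.proj p Γ n) := by rwa [hs]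
    have : (⟨i, hi⟩ : (T.I v).map (Gam.proj p Γ n)) = ⟨Gam.proj p Γ n (s i), hi'⟩ :=
      Subtype.ext (hs i).symm
    rw [this, t_starLevelEquiv]
    simp only [F, hs]
  rw [Fintype.sum_congr _ _ hF, hγ.sum_map_range n (T.levelExp p n v) _ (T.map_proj_I hI n v) F]
  refine Finset.sum_congr rfl fun j _ => ?_
  set i := (γ ^ p ^ T.levelExp p n v) ^ j with hi_def
  have hi : Gam.proj p Γ n i ∈ (T.I v).map (Gam.proj p Γ n) := by
    rw [T.map_proj_I hI]
    exact ⟨i, ⟨γ ^ j, by rw [hi_def, powMonoidHom_apply, ← pow_mul, ← pow_mul, mul_comm]⟩, rfl⟩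
  have h1 : T.vertexAt p n v (g * i) = T.vertexAt p n v g :=
    (SerreGraph.sigma_mk_eq_iff (I := fun v => (T.I v).map (Gam.proj p Γ n)) _ _ _ _).mpr
      ⟨rfl, by rw [map_mul, inv_mul_cancel_left]; exact hi⟩
  have h2 : T.vertexAt p n (T.X.t e) (g * s (Gam.proj p Γ n i) * T.α e) =
      T.vertexAt p n (T.X.t e) (g * i * T.α e) := by
    simp only [vertexAt, map_mul, hs]
    rfl
  rw [h1, ← h2]

/-! ### The Picard group at a finite level -/

section Free

variable [DecidableEq T.X.V]

/-- The multiple of `P_v` which maps to the Laplacian of `X_n` at `(v, g I_v)`, expanded. -/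
theorem of_mul_omegaQuot_smul_freeP (n k : ℕ) (v : T.X.V) (g : Γ) :
    (of p g * omegaQuot p γ n k) • T.freeP p v =
      ∑ e : T.X.star v, ∑ j ∈ Finset.range (p ^ (n - k)),
        (Pi.single v (of p (g * (γ ^ p ^ k) ^ j)) -
          Pi.single (T.X.t e) (of p (g * (γ ^ p ^ k) ^ j * T.α e)) :
            T.X.V → IwasawaAlgebra p Γ) := by
  rw [freeP, Finset.smul_sum]
  refine Finset.sum_congr rfl fun e _ => ?_
  rw [omegaQuot, Finset.mul_sum, Finset.sum_smul]
  refine Finset.sum_congr rfl fun j _ => ?_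
  rw [smul_sub, ← Pi.single_smul', ← Pi.single_smul', smul_eq_mul, smul_eq_mul, mul_one,
    ← of_mul, ← of_mul]

variable (p γ) in
/-- The relations between the classes of the basis vectors in `Pic_p(X_n)`, see `ker_picOfFree`. -/
abbrev freeRel (n : ℕ) : Submodule (IwasawaAlgebra p Γ) (T.X.V → IwasawaAlgebra p Γ) :=
  T.freeUnr γ ⊔ T.freeRam γ n

theorem omega_smul_mem_freeRel (n : ℕ) (f : T.X.V → IwasawaAlgebra p Γ) :
    omega p γ n • f ∈ T.freeRel p γ n :=
  Submodule.mem_sup_right <| Submodule.mem_sup_left <|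
    Submodule.smul_mem_smul (Ideal.mem_span_singleton_self _) trivial

theorem smul_omegaQuot_smul_freeP_mem_freeRel (n : ℕ) (v : T.X.V) (a : IwasawaAlgebra p Γ) :
    (a * omegaQuot p γ n (T.levelExp p n v)) • T.freeP p v ∈ T.freeRel p γ n := by
  rw [mul_smul]
  refine Submodule.smul_mem _ _ ?_
  by_cases hv : T.Ramified v
  · rw [levelExp, if_pos hv]
    exact Submodule.mem_sup_right <| Submodule.mem_sup_right <|
      Submodule.subset_span ⟨v, hv, rfl⟩
  · rw [levelExp, if_neg hv, omegaQuot_self, one_smul]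
    exact Submodule.mem_sup_left <| Submodule.mem_sup_right <|
      Submodule.subset_span ⟨v, hv, rfl⟩

theorem single_sub_single_mem_freeRel (hγ : IsProcyclicGenerator p γ)
    (hI : ∀ v, T.Ramified v → T.I v = (powMonoidHom (p ^ T.ramExp p v) : Γ →* Γ).range)
    {n : ℕ} {v : T.X.V} {g h : Γ} (hgh : T.vertexAt p n v g = T.vertexAt p n v h) :
    (Pi.single v (of p g) - Pi.single v (of p h) : T.X.V → IwasawaAlgebra p Γ) ∈
      T.freeRel p γ n := by
  obtain ⟨-, i, hi, x, rfl⟩ := (T.vertexAt_eq_iff n v v g h).mp hgh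
  have h1 : (Pi.single v (of p (h * i * x ^ p ^ n)) - Pi.single v (of p h) :
      T.X.V → IwasawaAlgebra p Γ) =
      Pi.single v (of p (h * i) * (of p (x ^ p ^ n) - 1)) +
        of p h • Pi.single v (of p i - 1) := by
    rw [← Pi.single_smul', ← Pi.single_sub, ← Pi.single_add, smul_eq_mul, of_mul (h * i), of_mul h]
    congr 1
    ring
  rw [h1]
  refine add_mem ?_ (Submodule.smul_mem _ _ ?_)
  · obtain ⟨y, hy⟩ := omega_dvd_of_pow_sub_one hγ n x
    rw [hy, mul_left_comm, ← smul_eq_mul, Pi.single_smul']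
    exact T.omega_smul_mem_freeRel n _
  · by_cases hv : T.Ramified v
    · rw [hI v hv] at hi
      obtain ⟨y, rfl⟩ := hi
      obtain ⟨z, hz⟩ := omega_dvd_of_pow_sub_one hγ (T.ramExp p v) y
      rw [powMonoidHom_apply, hz, mul_comm, ← smul_eq_mul, Pi.single_smul']
      exact Submodule.mem_sup_left <| Submodule.mem_sup_left <| Submodule.smul_mem _ _ <|
        Submodule.subset_span ⟨v, hv, rfl⟩
    · rw [not_not.mp hv, Subgroup.mem_bot] at hi
      rw [hi, of_one, sub_self, Pi.single_zero]
      exact zero_mem _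

/-- The map `Div(X_n) → Λ^V / freeRel` sending `(v, g I_v)` to the class of `g e_v`. -/
theorem exists_divToFree (hγ : IsProcyclicGenerator p γ)
    (hI : ∀ v, T.Ramified v → T.I v = (powMonoidHom (p ^ T.ramExp p v) : Γ →* Γ).range)
    (n : ℕ) : ∃ ψ : (T.level p n).Div →+
        ((T.X.V → IwasawaAlgebra p Γ) ⧸ T.freeRel p γ n),
      ∀ v g, ψ ((T.level p n).vertex (T.vertexAt p n v g)) =
        Submodule.Quotient.mk (Pi.single v (of p g)) := by
  choose v g h using T.exists_vertexAt_eq (p := p) n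
  refine ⟨SerreGraph.Div.lift fun w => Submodule.Quotient.mk (Pi.single (v w) (of p (g w))),
    fun v' g' => ?_⟩
  rw [SerreGraph.Div.lift_vertex, Submodule.Quotient.eq]
  have h1 := h (T.vertexAt p n v' g')
  obtain ⟨h2, -⟩ := (T.vertexAt_eq_iff n _ _ _ _).mp h1
  rw [← h2] at h1 ⊢
  exact T.single_sub_single_mem_freeRel hγ hI h1.symm

/-- The inverse of the map `Λ^V / freeRel → Pic_p(X_n)`, as an additive map: the map on divisors
kills the Laplacians, which go to multiples of the relations `ω_{n,k} P_v`. -/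
theorem exists_picToFree (hγ : IsProcyclicGenerator p γ)
    (hI : ∀ v, T.Ramified v → T.I v = (powMonoidHom (p ^ T.ramExp p v) : Γ →* Γ).range)
    (n : ℕ) : ∃ ψ : T.PicP p n →+ ((T.X.V → IwasawaAlgebra p Γ) ⧸ T.freeRel p γ n),
      ∀ r v g, ψ (PExt.tmul p (Gam p Γ n) r (SerreGraph.Pic.mk (T.level p n)
          ((T.level p n).vertex (T.vertexAt p n v g)))) =
        Submodule.Quotient.mk (Pi.single v (const p Γ r * of p g)) := by
  obtain ⟨ψ, hψ⟩ := T.exists_divToFree hγ hI n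
  have hPr : (T.level p n).Pr ≤ ψ.ker := by
    rintro _ ⟨D, rfl⟩
    have : ψ.comp (T.level p n).laplacian = 0 := by
      refine SerreGraph.Div.hom_ext fun w => ?_
      obtain ⟨v, g, rfl⟩ := T.exists_vertexAt_eq n w
      rw [AddMonoidHom.comp_apply, T.laplacian_vertexAt hγ hI, AddMonoidHom.zero_apply]
      simp only [map_sum, map_sub, hψ, ← Submodule.Quotient.mk_sub]
      have := T.smul_omegaQuot_smul_freeP_mem_freeRel (γ := γ) n v (of p g)
      rw [of_mul_omegaQuot_smul_freeP, ← Submodule.Quotient.mk_eq_zero] at this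
      rw [← this]
      change _ = Submodule.mkQ _ _
      simp only [map_sum]
      rfl
    exact DFunLike.congr_fun this D
  let ψ₁ : (T.level p n).Pic →+ _ := QuotientAddGroup.lift _ ψ hPr
  let M := (T.X.V → IwasawaAlgebra p Γ) ⧸ T.freeRel p γ n
  let b : ℤ_[p] →+ (T.level p n).Pic →+ M :=
    { toFun := fun r => (DistribSMul.toAddMonoidHom M (const p Γ r)).comp ψ₁
      map_zero' := AddMonoidHom.ext fun x => by simp
      map_add' := fun r s => AddMonoidHom.ext fun x => by simp [add_smul] }
  refine ⟨TensorProduct.liftAddHom b fun k r x => ?_, fun r v g => ?_⟩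
  · change const p Γ (k • r) • ψ₁ x = const p Γ r • ψ₁ (k • x)
    rw [map_zsmul, map_zsmul, smul_assoc, smul_comm]
  · change const p Γ r • ψ ((T.level p n).vertex (T.vertexAt p n v g)) = _
    rw [hψ, ← Submodule.Quotient.mk_smul, ← Pi.single_smul', smul_eq_mul]

variable [Fintype T.X.V]

omit [∀ v, Fintype (T.X.star v)]

variable (p) in
/-- The map `Λ^V → Pic_p(X_n)` mapping the basis vector at `v` to the class of `(v, I_v)`. -/
def picOfFree (n : ℕ) : (T.X.V → IwasawaAlgebra p Γ) →ₗ[IwasawaAlgebra p Γ] T.PicP p n :=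
  T.picMkLambda p n ∘ₗ T.piLambda p n ∘ₗ T.ofFree p

omit [DecidableEq T.X.V] [Fintype T.X.V] in
theorem piLambda_toLambda (n : ℕ) (D : T.Xinf.Div) : T.piLambda p n (T.toLambda p D) =
    PExt.tmul p (Gam p Γ n) 1 ((T.coverInf p n).pushDiv D) := by
  change T.piLambda p n (1 ⊗ₜ[MonoidAlgebra ℤ_[p] Γ] PExt.tmul p Γ 1 D) = _
  rw [piLambda]
  refine (LinearMap.liftBaseChange_tmul _ _ _ _).trans ?_
  rw [one_smul]
  rfl

theorem picOfFree_single (n : ℕ) (v : T.X.V) (r : ℤ_[p]) (g : Γ) :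
    T.picOfFree p n (Pi.single v (const p Γ r * of p g)) =
      PExt.tmul p (Gam p Γ n) r (SerreGraph.Pic.mk (T.level p n)
        ((T.level p n).vertex (T.vertexAt p n v g))) := by
  rw [picOfFree, LinearMap.comp_apply, LinearMap.comp_apply, ofFree_single, map_smul, map_smul,
    piLambda_toLambda, SerreGraph.Hom.pushDiv_vertex]
  change _ • PExt.tmul p (Gam p Γ n) 1 (SerreGraph.Pic.mk _ _) = _
  rw [PExt.const_mul_of_smul_tmul, mul_one]
  change PExt.tmul p (Gam p Γ n) r (SerreGraph.Pic.mk _ (Gam.proj p Γ n g •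
    (T.level p n).vertex _)) = _
  rw [SerreGraph.smul_vertex]
  change _ = PExt.tmul p (Gam p Γ n) r (SerreGraph.Pic.mk _ ((T.level p n).vertex
    (T.vertexAt p n v g)))
  have : Gam.proj p Γ n g • (T.coverInf p n).onV (T.vertexInf v 1) = T.vertexAt p n v g := by
    change T.vertexAt p n v (g * 1) = _
    rw [mul_one]
  rw [this]

theorem picOfFree_single_of (n : ℕ) (v : T.X.V) (g : Γ) :
    T.picOfFree p n (Pi.single v (of p g)) =
      PExt.tmul p (Gam p Γ n) 1 (SerreGraph.Pic.mk (T.level p n)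
        ((T.level p n).vertex (T.vertexAt p n v g))) := by
  rw [← picOfFree_single, map_one, one_mul]

theorem picOfFree_surjective (n : ℕ) : Function.Surjective (T.picOfFree p n) := by
  intro x
  change x ∈ LinearMap.range (T.picOfFree p n)
  induction x using PExt.induction with
  | h0 => exact zero_mem _
  | h2 x y hx hy => exact add_mem hx hy
  | h1 r x =>
    induction x using QuotientAddGroup.induction_on with | H D =>
    let f : (T.level p n).Div →+ T.PicP p n ⧸ LinearMap.range (T.picOfFree p n) :=
      (Submodule.mkQ _).toAddMonoidHom.comp
        ((TensorProduct.mk ℤ ℤ_[p] (T.level p n).Pic r).toAddMonoidHom.comp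
          (SerreGraph.Pic.mk (T.level p n)))
    have hf : f = 0 := SerreGraph.Div.hom_ext fun w => by
      obtain ⟨v, g, rfl⟩ := T.exists_vertexAt_eq n w
      exact (Submodule.Quotient.mk_eq_zero _).mpr ⟨_, T.picOfFree_single n v r g⟩
    exact (Submodule.Quotient.mk_eq_zero _).mp (DFunLike.congr_fun hf D)

omit [DecidableEq T.X.V] [Fintype T.X.V] in
theorem omega_smul_eq_zero (n : ℕ) (x : T.PicP p n) : omega p γ n • x = 0 := by
  rw [smul_eq_ev_smul, ev_omega le_rfl, zero_smul]

theorem ker_picOfFree [∀ v, Fintype (T.X.star v)] (hγ : IsProcyclicGenerator p γ)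
    (hI : ∀ v, T.Ramified v → T.I v = (powMonoidHom (p ^ T.ramExp p v) : Γ →* Γ).range)
    (n : ℕ) : LinearMap.ker (T.picOfFree p n) = T.freeRel p γ n := by
  have hP : ∀ v, T.picOfFree p n (omegaQuot p γ n (T.levelExp p n v) • T.freeP p v) = 0 := by
    intro v
    have h1 := T.of_mul_omegaQuot_smul_freeP (p := p) (γ := γ) n (T.levelExp p n v) v 1
    have h2 := T.laplacian_vertexAt hγ hI n v 1
    rw [of_one, one_mul] at h1
    have h3 : SerreGraph.Pic.mk _ ((T.level p n).laplacian
        ((T.level p n).vertex (T.vertexAt p n v 1))) = 0 :=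
      (QuotientAddGroup.eq_zero_iff _).mpr ⟨_, rfl⟩
    let m : (T.level p n).Pic →+ T.PicP p n :=
      (TensorProduct.mk ℤ ℤ_[p] (T.level p n).Pic 1).toAddMonoidHom
    have h4 : ∀ v g, T.picOfFree p n (Pi.single v (of p g)) =
      m (SerreGraph.Pic.mk _ ((T.level p n).vertex (T.vertexAt p n v g))) :=
        fun v g => T.picOfFree_single_of n v g
    rw [h1, ← map_zero m, ← h3, h2]
    simp only [map_sum, map_sub, h4]
  apply le_antisymm
  · intro x hx
    obtain ⟨ψ, hψ⟩ := T.exists_picToFree hγ hI n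
    have key : ψ.comp (T.picOfFree p n).toAddMonoidHom =
        (Submodule.mkQ (T.freeRel p γ n)).toAddMonoidHom := by
      refine AddMonoidHom.functions_ext _ _ _ fun v a => ?_
      change ψ (T.picOfFree p n (Pi.single v a)) = Submodule.Quotient.mk (Pi.single v a)
      -- `ψ` is only additive, so it is evaluated on `ℤ_p[Γ]`; both sides vanish on `ω_n Λ^V`.
      obtain ⟨b, y, rfl⟩ := exists_eq_algebraMap_add hγ n a
      have hy : (Pi.single v (omega p γ n * y) : T.X.V → IwasawaAlgebra p Γ) =
          omega p γ n • Pi.single v y := by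
        rw [← Pi.single_smul', smul_eq_mul]
      rw [Pi.single_add, map_add, hy, map_smul, omega_smul_eq_zero, add_zero,
        Submodule.Quotient.mk_add,
        (Submodule.Quotient.mk_eq_zero _).mpr (T.omega_smul_mem_freeRel n _), add_zero]
      induction b using MonoidAlgebra.induction_linear with
      | zero => simp
      | add b c hb hc =>
        rw [map_add, Pi.single_add, map_add, map_add, hb, hc, Submodule.Quotient.mk_add]
      | single g r => rw [algebraMap_single, picOfFree_single, hψ]
    have := DFunLike.congr_fun key x
    rw [← Submodule.Quotient.mk_eq_zero]
    refine this.symm.trans ?_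
    change ψ (T.picOfFree p n x) = 0
    rw [LinearMap.mem_ker.mp hx, map_zero]
  · refine sup_le (sup_le ?_ ?_) (sup_le ?_ ?_)
    · rw [Submodule.span_le]
      rintro _ ⟨v, hv, rfl⟩
      change T.picMkLambda p n (T.piLambda p n (T.ofFree p _)) = 0
      rw [T.ofFree_single_omega (hI v hv), map_zero, map_zero]
    · rw [Submodule.span_le]
      rintro _ ⟨v, hv, rfl⟩
      have := hP v
      rwa [levelExp, if_neg hv, omegaQuot_self, one_smul] at this
    · rw [Submodule.smul_le]
      intro a ha f _
      obtain ⟨b, rfl⟩ := Ideal.mem_span_singleton'.mp ha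
      rw [LinearMap.mem_ker, map_smul, mul_smul, omega_smul_eq_zero, smul_zero]
    · rw [Submodule.span_le]
      rintro _ ⟨v, hv, rfl⟩
      have := hP v
      rwa [levelExp, if_pos hv] at this

/-- The kernel of `Div_Λ(X_∞) → Pic_p(X_n)` is `N_n`. -/
theorem picMkLambda_piLambda_eq_zero_iff [∀ v, Fintype (T.X.star v)]
    (hγ : IsProcyclicGenerator p γ)
    (hI : ∀ v, T.Ramified v → T.I v = (powMonoidHom (p ^ T.ramExp p v) : Γ →* Γ).range)
    (n : ℕ) (D : T.DivLambda p) :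
    T.picMkLambda p n (T.piLambda p n D) = 0 ↔ D ∈ T.N p γ n := by
  rw [← T.map_ofFree_sup hI n]
  constructor
  · intro hD
    obtain ⟨f, rfl⟩ := T.ofFree_surjective D
    refine ⟨f, ?_, rfl⟩
    have : f ∈ LinearMap.ker (T.picOfFree p n) := hD
    rwa [T.ker_picOfFree hγ hI] at this
  · rintro ⟨f, hf, rfl⟩
    have : f ∈ LinearMap.ker (T.picOfFree p n) := by rwa [T.ker_picOfFree hγ hI]
    exact this

end Free

end VoltageDatum

/-! ### Passage to the limit -/

namespace IwasawaAlgebra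

variable {p : ℕ} [Fact p.Prime] {Γ : Type*} [CommGroup Γ] {γ : Γ}

/-- Finitely generated submodules of `Λ^ι` are closed, as continuous images of compact spaces. -/
theorem isClosed_of_fg [∀ n, Finite (Gam p Γ n)] {ι : Type*}
    {S : Submodule (IwasawaAlgebra p Γ) (ι → IwasawaAlgebra p Γ)} (hS : S.FG) :
    IsClosed (S : Set (ι → IwasawaAlgebra p Γ)) := by
  obtain ⟨k, f, rfl⟩ := S.fg_iff_exists_fin_linearMap.mp hS
  have hf : Continuous f := by
    have : (f : (Fin k → IwasawaAlgebra p Γ) → ι → IwasawaAlgebra p Γ) =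
        fun c => ∑ i, c i • f (Pi.single i 1) := funext fun c => by
      conv_lhs => rw [← Finset.univ_sum_single c, map_sum]
      refine Finset.sum_congr rfl fun i _ => ?_
      rw [← map_smul, ← Pi.single_smul', smul_eq_mul, mul_one]
    rw [this]
    refine continuous_finsetSum _ fun i _ => continuous_pi fun v => ?_
    have hc : Continuous fun c : Fin k → IwasawaAlgebra p Γ => f (Pi.single i 1) v • c i :=
      (continuous_const_smul _).comp (continuous_apply i)
    refine hc.congr fun c => ?_
    rw [Pi.smul_apply, smul_eq_mul, smul_eq_mul, mul_comm]
  exact (isCompact_range hf).isClosed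

theorem norm_coeff_le_of_pow_dvd {m j : ℕ} {x : MonoidAlgebra ℤ_[p] (Gam p Γ m)}
    (h : (p : MonoidAlgebra ℤ_[p] (Gam p Γ m)) ^ j ∣ x) (g : Gam p Γ m) :
    ‖x.coeff g‖ ≤ ((p : ℝ)⁻¹) ^ j := by
  obtain ⟨y, rfl⟩ := h
  rw [← Nat.cast_pow, ← nsmul_eq_mul, MonoidAlgebra.coeff_smul_apply, nsmul_eq_mul, norm_mul,
    Nat.cast_pow, norm_pow, PadicInt.norm_p]
  exact mul_le_of_le_one_right (by positivity) (PadicInt.norm_le_one _)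

/-- A sequence in `Λ^ι` tends to zero if its components are more and more divisible by `p`. -/
theorem tendsto_zero_of_pow_dvd {ι : Type*} {a : ℕ → ι → IwasawaAlgebra p Γ} (K : ℕ)
    (h : ∀ m j n v, K + m + j ≤ n →
      (p : MonoidAlgebra ℤ_[p] (Gam p Γ m)) ^ j ∣ ev p Γ m (a n v)) :
    Filter.Tendsto a Filter.atTop (nhds 0) := by
  refine tendsto_pi_nhds.mpr fun v => ?_
  have hind : Topology.IsInducing (coeffs (p := p) (Γ := Γ)) := ⟨rfl⟩
  rw [hind.tendsto_nhds_iff]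
  refine tendsto_pi_nhds.mpr fun m => tendsto_pi_nhds.mpr fun g => ?_
  have hp : (1 : ℝ) < p := by exact_mod_cast (Fact.out : p.Prime).one_lt
  have hlim : Filter.Tendsto (fun n : ℕ => ((p : ℝ)⁻¹) ^ (n - (K + m))) Filter.atTop (nhds 0) :=
    (tendsto_pow_atTop_nhds_zero_of_lt_one (by positivity) (inv_lt_one_of_one_lt₀ hp)).comp
      (Filter.tendsto_sub_atTop_nat _)
  have h0 : coeffs (0 : IwasawaAlgebra p Γ) m g = 0 := by
    rw [coeffs, map_zero]
    rfl
  change Filter.Tendsto _ _ (nhds (coeffs (0 : IwasawaAlgebra p Γ) m g))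
  rw [h0]
  refine squeeze_zero_norm' ?_ hlim
  filter_upwards [Filter.eventually_ge_atTop (K + m)] with n hn
  exact norm_coeff_le_of_pow_dvd (h m (n - (K + m)) n v (by omega)) g

end IwasawaAlgebra

/-- A surjection with kernel `S` induces an isomorphism from the quotient by `S`. -/
theorem LinearMap.exists_quotientEquiv {R M N : Type*} [Ring R] [AddCommGroup M] [AddCommGroup N]
    [Module R M] [Module R N] {f : M →ₗ[R] N} (hf : Function.Surjective f) {S : Submodule R M}
    (hS : ∀ x, f x = 0 ↔ x ∈ S) :
    ∃ e : (M ⧸ S) ≃ₗ[R] N, ∀ x, e (Submodule.Quotient.mk x) = f x :=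
  ⟨(Submodule.quotEquivOfEq S (LinearMap.ker f)
    (Submodule.ext fun x => (hS x).symm)).trans (f.quotKerEquivOfSurjective hf), fun _ => rfl⟩

namespace VoltageDatum

open IwasawaAlgebra

variable {p : ℕ} [Fact p.Prime] {Γ : Type*} [CommGroup Γ] {γ : Γ} (T : VoltageDatum.{u, v} Γ)

variable [Fintype T.X.V] [DecidableEq T.X.V]

theorem picTrans_picOfFree (n : ℕ) (f : T.X.V → IwasawaAlgebra p Γ) :
    T.picTrans p n (T.picOfFree p (n + 1) f) = T.picOfFree p n f := by
  let t : T.PicP p (n + 1) →ₗ[IwasawaAlgebra p Γ] T.PicP p n :=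
    { toFun := T.picTrans p n
      map_add' := map_add _
      map_smul' := T.picTrans_smul p n }
  have : t ∘ₗ T.picOfFree p (n + 1) = T.picOfFree p n := by
    refine (Pi.basisFun (IwasawaAlgebra p Γ) T.X.V).ext fun v => ?_
    rw [Pi.basisFun_apply, ← of_one, LinearMap.comp_apply, picOfFree_single_of,
      picOfFree_single_of]
    change PExt.tmul p (Gam p Γ n) 1 (SerreGraph.Pic.mk _
      ((T.cover p n).pushDiv ((T.level p (n + 1)).vertex _))) = _
    rw [SerreGraph.Hom.pushDiv_vertex]
    rfl
  exact LinearMap.congr_fun this f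

theorem picTrans_picMkLambda (n : ℕ) (D : T.DivLambda p) :
    T.picTrans p n (T.picMkLambda p (n + 1) (T.piLambda p (n + 1) D)) =
      T.picMkLambda p n (T.piLambda p n D) := by
  obtain ⟨f, rfl⟩ := T.ofFree_surjective D
  exact T.picTrans_picOfFree n f

variable [∀ v, Fintype (T.X.star v)]

theorem fg_freeUnr : (T.freeUnr (p := p) γ).FG := by
  refine Submodule.FG.sup (Submodule.fg_span ?_) (Submodule.fg_span ?_)
  · refine (Set.finite_range fun v => (Pi.single v (omega p γ (T.ramExp p v)) :
      T.X.V → IwasawaAlgebra p Γ)).subset ?_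
    rintro _ ⟨v, -, rfl⟩
    exact ⟨v, rfl⟩
  · refine (Set.finite_range (T.freeP p)).subset ?_
    rintro _ ⟨v, -, rfl⟩
    exact ⟨v, rfl⟩

theorem fg_freeRam (n : ℕ) : (T.freeRam (p := p) γ n).FG := by
  refine Submodule.FG.sup ?_ (Submodule.fg_span ?_)
  · exact Submodule.FG.smul (Submodule.fg_span_singleton _) Module.Finite.fg_top
  · refine (Set.finite_range fun v =>
      omegaQuot p γ n (T.ramExp p v) • T.freeP p v).subset ?_
    rintro _ ⟨v, -, rfl⟩
    exact ⟨v, rfl⟩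

omit [Fintype T.X.V] in
theorem pow_dvd_ev_of_mem_freeRam {m j n K : ℕ} (hK : ∀ v, T.ramExp p v ≤ K)
    (hn : K + m + j ≤ n) {f : T.X.V → IwasawaAlgebra p Γ} (hf : f ∈ T.freeRam γ n) (w : T.X.V) :
    (p : MonoidAlgebra ℤ_[p] (Gam p Γ m)) ^ j ∣ ev p Γ m (f w) := by
  let J : Ideal (IwasawaAlgebra p Γ) :=
    (Ideal.span {(p : MonoidAlgebra ℤ_[p] (Gam p Γ m)) ^ j}).comap (ev p Γ m)
  have hJ : ∀ a, a ∈ J ↔ (p : MonoidAlgebra ℤ_[p] (Gam p Γ m)) ^ j ∣ ev p Γ m a := fun a => by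
    rw [Ideal.mem_comap, Ideal.mem_span_singleton]
  have hle : T.freeRam γ n ≤ Submodule.comap (LinearMap.proj w) J := by
    refine sup_le ?_ ?_
    · rw [Submodule.smul_le]
      intro a ha f _
      refine J.mul_mem_right _ ?_
      obtain ⟨b, rfl⟩ := Ideal.mem_span_singleton'.mp ha
      refine J.mul_mem_left _ ?_
      rw [hJ, ev_omega (by omega)]
      exact dvd_zero _
    · rw [Submodule.span_le]
      rintro _ ⟨v, hv, rfl⟩
      refine J.mul_mem_right _ ?_
      rw [hJ]
      exact pow_dvd_ev_omegaQuot (by have := hK v; omega)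
  exact (hJ _).mp (hle hf)

/-- The intersection of the modules of relations at the finite levels is the module of relations
at infinity, as the latter is closed and the remaining relations tend to zero. -/
theorem mem_freeUnr_of_forall_mem_freeRel [∀ n, Finite (Gam p Γ n)]
    {f : T.X.V → IwasawaAlgebra p Γ} (hf : ∀ n, f ∈ T.freeRel p γ n) : f ∈ T.freeUnr γ := by
  have h : ∀ n, ∃ a ∈ T.freeRam γ n, f - a ∈ T.freeUnr (p := p) γ := fun n => by
    obtain ⟨u, hu, a, ha, rfl⟩ := Submodule.mem_sup.mp (hf n)
    exact ⟨a, ha, by rwa [add_sub_cancel_right]⟩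
  choose a ha hfa using h
  have hlim : Filter.Tendsto a Filter.atTop (nhds 0) :=
    tendsto_zero_of_pow_dvd (Finset.univ.sup fun v => T.ramExp p v) fun m j n v hn =>
      T.pow_dvd_ev_of_mem_freeRam
        (fun v => Finset.le_sup (f := fun v => T.ramExp p v) (Finset.mem_univ v)) hn (ha n) v
  have := (tendsto_const_nhds (x := f)).sub hlim
  rw [sub_zero] at this
  exact (isClosed_of_fg T.fg_freeUnr).mem_of_tendsto this (Filter.Eventually.of_forall hfa)

/-- The fibres of the maps `Λ^V → Pic_p(X_n)` over a compatible sequence are nested non-empty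
compact sets, hence have a common point. -/
theorem exists_picOfFree_eq (hγ : IsProcyclicGenerator p γ)
    (hI : ∀ v, T.Ramified v → T.I v = (powMonoidHom (p ^ T.ramExp p v) : Γ →* Γ).range)
    {x : ∀ n, T.PicP p n} (hx : x ∈ T.PicLambda p) : ∃ f, ∀ n, T.picOfFree p n f = x n := by
  have := hγ.finite_gam
  have hcl : ∀ n, IsClosed {f | T.picOfFree p n f = x n} := fun n => by
    obtain ⟨f₀, hf₀⟩ := T.picOfFree_surjective n (x n)
    have h1 : {f | T.picOfFree p n f = x n} =
        (fun f => f - f₀) ⁻¹' (T.freeRel p γ n : Set (T.X.V → IwasawaAlgebra p Γ)) := by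
      ext f
      rw [Set.mem_preimage, SetLike.mem_coe, ← T.ker_picOfFree hγ hI, LinearMap.mem_ker, map_sub,
        hf₀, sub_eq_zero]
      rfl
    rw [h1]
    exact (isClosed_of_fg (T.fg_freeUnr.sup (T.fg_freeRam n))).preimage
      (continuous_id.sub continuous_const)
  obtain ⟨f, hf⟩ := IsCompact.nonempty_iInter_of_sequence_nonempty_isCompact_isClosed
    (fun n => {f | T.picOfFree p n f = x n})
    (fun n f (hf : _ = _) => by
      change T.picOfFree p n f = x n
      rw [← picTrans_picOfFree, hf]
      exact hx n)
    (fun n => T.picOfFree_surjective n (x n)) (hcl 0).isCompact hcl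
  exact ⟨f, fun n => Set.mem_iInter.mp hf n⟩

omit [∀ v, Fintype (T.X.star v)] in
variable (p) in
/-- The map `Div_Λ(X_∞) → Pic_Λ` induced by the `π_n`. -/
def toPicLambda : T.DivLambda p →ₗ[IwasawaAlgebra p Γ] T.PicLambda p :=
  (LinearMap.pi fun n => T.picMkLambda p n ∘ₗ T.piLambda p n).codRestrict (T.PicLambda p)
    fun D n => T.picTrans_picMkLambda n D

theorem toPicLambda_surjective (hγ : IsProcyclicGenerator p γ)
    (hI : ∀ v, T.Ramified v → T.I v = (powMonoidHom (p ^ T.ramExp p v) : Γ →* Γ).range) :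
    Function.Surjective (T.toPicLambda p) := by
  rintro ⟨x, hx⟩
  obtain ⟨f, hf⟩ := T.exists_picOfFree_eq hγ hI hx
  exact ⟨T.ofFree p f, Subtype.ext (funext hf)⟩

theorem forall_picMkLambda_eq_zero_iff (hγ : IsProcyclicGenerator p γ)
    (hI : ∀ v, T.Ramified v → T.I v = (powMonoidHom (p ^ T.ramExp p v) : Γ →* Γ).range)
    (D : T.DivLambda p) :
    (∀ n, T.picMkLambda p n (T.piLambda p n D) = 0) ↔ D ∈ T.PrUnr p := by
  have := hγ.finite_gam
  constructor
  · intro h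
    obtain ⟨f, rfl⟩ := T.ofFree_surjective D
    rw [← T.map_ofFree_freeUnr (γ := γ) hI]
    refine ⟨f, T.mem_freeUnr_of_forall_mem_freeRel fun n => ?_, rfl⟩
    rw [← T.ker_picOfFree hγ hI]
    exact h n
  · exact fun hD n => (T.picMkLambda_piLambda_eq_zero_iff hγ hI n D).mpr
      (Submodule.mem_sup_right hD)

end VoltageDatum

/-! ### Divisors of degree zero -/

namespace SerreGraph

theorem deg_vertex (Y : SerreGraph) (w : Y.V) : Y.deg (Y.vertex w) = 1 := Div.lift_vertex _ _

theorem deg_laplacian (Y : SerreGraph) (D : Y.Div) : Y.deg (Y.laplacian D) = 0 := by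
  have : Y.deg.comp Y.laplacian = 0 := Div.hom_ext fun w => by
    rw [AddMonoidHom.comp_apply, AddMonoidHom.zero_apply]
    rcases finite_or_infinite (Y.star w) with h | h
    · have := Fintype.ofFinite (Y.star w)
      rw [laplacian_vertex_of_finite, map_sum]
      exact Finset.sum_eq_zero fun e _ => by rw [map_sub, deg_vertex, deg_vertex, sub_self]
    · rw [laplacian_vertex_of_infinite Y w h, map_zero]
  exact DFunLike.congr_fun this D

/-- The degree map on `Pic(Y)`. -/
def degPic (Y : SerreGraph) : Y.Pic →+ ℤ :=
  QuotientAddGroup.lift Y.Pr Y.deg (by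
    rintro _ ⟨D, rfl⟩
    exact deg_laplacian Y D)

theorem degPic_mk (Y : SerreGraph) (D : Y.Div) : Y.degPic (Pic.mk Y D) = Y.deg D := rfl

theorem Pic0.toPic_injective (Y : SerreGraph) : Function.Injective (Pic0.toPic Y) := by
  rw [injective_iff_map_eq_zero]
  intro x hx
  induction x using QuotientAddGroup.induction_on with | H D =>
  exact (QuotientAddGroup.eq_zero_iff D).mpr ((QuotientAddGroup.eq_zero_iff (D : Y.Div)).mp hx)

theorem degPic_eq_zero_iff (Y : SerreGraph) (x : Y.Pic) :
    Y.degPic x = 0 ↔ ∃ y, Pic0.toPic Y y = x := by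
  constructor
  · intro hx
    induction x using QuotientAddGroup.induction_on with | H D =>
    exact ⟨QuotientAddGroup.mk' _ (⟨D, hx⟩ : Y.Div0), rfl⟩
  · rintro ⟨y, rfl⟩
    induction y using QuotientAddGroup.induction_on with | H D =>
    exact D.2

end SerreGraph

namespace VoltageDatum

open IwasawaAlgebra

variable {p : ℕ} [Fact p.Prime] {Γ : Type*} [CommGroup Γ] {γ : Γ} (T : VoltageDatum.{u, v} Γ)

variable (p) in
/-- The `Λ`-linear map `Pic⁰_p(X_n) → Pic_p(X_n)`. -/
def pic0ToPicLambda (n : ℕ) : T.Pic0P p n →ₗ[IwasawaAlgebra p Γ] T.PicP p n :=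
  PExt.mapLambda (SerreGraph.Pic0.toPic (T.level p n)) fun g x => by
    induction x using QuotientAddGroup.induction_on with | H D => rfl

variable (p) in
/-- The degree map `Pic_p(X_n) → ℤ_p`. -/
def degPicP (n : ℕ) : T.PicP p n →+ ℤ_[p] :=
  show ℤ_[p] ⊗[ℤ] (T.level p n).Pic →+ ℤ_[p] from
    ((TensorProduct.rid ℤ ℤ_[p]).toLinearMap ∘ₗ
      LinearMap.lTensor ℤ_[p] (T.level p n).degPic.toIntLinearMap).toAddMonoidHom

theorem degPicP_tmul (n : ℕ) (r : ℤ_[p]) (x : (T.level p n).Pic) :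
    T.degPicP p n (PExt.tmul p (Gam p Γ n) r x) = (T.level p n).degPic x • r := rfl

/-- `ℤ_p` is flat over `ℤ`. -/
theorem pic0ToPicLambda_injective (n : ℕ) : Function.Injective (T.pic0ToPicLambda p n) :=
  Module.Flat.lTensor_preserves_injective_linearMap (M := ℤ_[p])
    (SerreGraph.Pic0.toPic (T.level p n)).toIntLinearMap
    (SerreGraph.Pic0.toPic_injective (T.level p n))

theorem degPicP_eq_zero_iff (n : ℕ) (x : T.PicP p n) :
    T.degPicP p n x = 0 ↔ ∃ y, T.pic0ToPicLambda p n y = x := by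
  have hex : Function.Exact (SerreGraph.Pic0.toPic (T.level p n)).toIntLinearMap
      (T.level p n).degPic.toIntLinearMap := fun x => SerreGraph.degPic_eq_zero_iff _ x
  refine Iff.trans ?_ (Module.Flat.lTensor_exact ℤ_[p] hex x)
  exact (TensorProduct.rid ℤ ℤ_[p]).map_eq_zero_iff

end VoltageDatum

namespace IwasawaAlgebra

variable (p : ℕ) [Fact p.Prime] (Γ : Type*) [CommGroup Γ]

/-- The augmentation `Λ → ℤ_p`, computed at level `n`. -/
def augmentation (n : ℕ) : IwasawaAlgebra p Γ →+* ℤ_[p] :=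
  (MonoidAlgebra.lift ℤ_[p] ℤ_[p] (Gam p Γ n) 1).toRingHom.comp (ev p Γ n)

variable {p Γ} {γ : Γ}

theorem augmentation_algebraMap (n : ℕ) (a : MonoidAlgebra ℤ_[p] Γ) :
    augmentation p Γ n (algebraMap _ _ a) = MonoidAlgebra.lift ℤ_[p] ℤ_[p] Γ 1 a := by
  change MonoidAlgebra.lift ℤ_[p] ℤ_[p] (Gam p Γ n) 1
    (MonoidAlgebra.mapDomainRingHom ℤ_[p] (Gam.proj p Γ n) a) = _
  induction a using MonoidAlgebra.induction_linear with
  | zero => simp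
  | add a b ha hb => rw [map_add, map_add, ha, hb, map_add]
  | single g r =>
    rw [MonoidAlgebra.mapDomainRingHom_apply, MonoidAlgebra.mapDomain_single,
      MonoidAlgebra.lift_single, MonoidAlgebra.lift_single]
    rfl

theorem augmentation_omega_mul (n : ℕ) (y : IwasawaAlgebra p Γ) :
    augmentation p Γ n (omega p γ n * y) = 0 := by
  have : augmentation p Γ n (omega p γ n) = 0 := by
    rw [augmentation, RingHom.comp_apply, ev_omega le_rfl, map_zero]
  rw [map_mul, this, zero_mul]

/-- The generator of `Λ ⊗ ℤ_p`. -/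
def trivialOne (p : ℕ) [Fact p.Prime] (Γ : Type*) [CommGroup Γ] :
    IwasawaAlgebra p Γ ⊗[MonoidAlgebra ℤ_[p] Γ] TrivialZp p Γ :=
  1 ⊗ₜ (show TrivialZp p Γ from (1 : ℤ_[p]))

theorem algebraMap_smul_trivialOne (a : MonoidAlgebra ℤ_[p] Γ) :
    (algebraMap _ (IwasawaAlgebra p Γ) a) • trivialOne p Γ =
      1 ⊗ₜ (show TrivialZp p Γ from MonoidAlgebra.lift ℤ_[p] ℤ_[p] Γ 1 a) := by
  have h : a • (show TrivialZp p Γ from (1 : ℤ_[p])) =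
      (show TrivialZp p Γ from MonoidAlgebra.lift ℤ_[p] ℤ_[p] Γ 1 a) :=
    mul_one (MonoidAlgebra.lift ℤ_[p] ℤ_[p] Γ 1 a)
  rw [← h, ← TensorProduct.smul_tmul, Algebra.smul_def]
  rfl

/-- The kernel of `Λ → Λ ⊗ ℤ_p`, where `Γ` acts trivially on `ℤ_p`, is the augmentation ideal. -/
theorem smul_trivialOne_eq_zero_iff (hγ : IsProcyclicGenerator p γ) (n : ℕ)
    (s : IwasawaAlgebra p Γ) : s • trivialOne p Γ = 0 ↔ augmentation p Γ n s = 0 := by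
  constructor
  · intro hs
    let b : IwasawaAlgebra p Γ →+ TrivialZp p Γ →+ ℤ_[p] :=
      AddMonoidHom.mul.comp (augmentation p Γ n).toAddMonoidHom
    let l : IwasawaAlgebra p Γ ⊗[MonoidAlgebra ℤ_[p] Γ] TrivialZp p Γ →+ ℤ_[p] :=
      TensorProduct.liftAddHom b fun a x z => by
        change augmentation p Γ n (a • x) * (show ℤ_[p] from z) = augmentation p Γ n x *
          (MonoidAlgebra.lift ℤ_[p] ℤ_[p] Γ 1 a * (show ℤ_[p] from z))
        rw [Algebra.smul_def, map_mul, augmentation_algebraMap]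
        ring
    have h1 : l (s • trivialOne p Γ) = augmentation p Γ n (s * 1) * 1 := rfl
    rw [mul_one, mul_one, hs, map_zero] at h1
    exact h1.symm
  · intro hs
    obtain ⟨a, y, rfl⟩ := exists_eq_algebraMap_add hγ n s
    have homega : omega p γ n • trivialOne p Γ = 0 := by
      have h : omega p γ n = algebraMap _ _
          (MonoidAlgebra.of ℤ_[p] Γ (γ ^ p ^ n) - 1 : MonoidAlgebra ℤ_[p] Γ) := by
        rw [map_sub, map_one, omega, of]
      have h0 : MonoidAlgebra.lift ℤ_[p] ℤ_[p] Γ 1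
          (MonoidAlgebra.of ℤ_[p] Γ (γ ^ p ^ n) - 1 : MonoidAlgebra ℤ_[p] Γ) = 0 := by
        rw [map_sub (MonoidAlgebra.lift ℤ_[p] ℤ_[p] Γ 1), map_one (MonoidAlgebra.lift _ _ _ _),
          MonoidAlgebra.lift_of, MonoidHom.one_apply, sub_self]
      rw [h, algebraMap_smul_trivialOne, h0]
      exact TensorProduct.tmul_zero _ _
    rw [map_add, augmentation_omega_mul, add_zero, augmentation_algebraMap] at hs
    rw [add_smul, mul_comm, mul_smul, homega, smul_zero, add_zero, algebraMap_smul_trivialOne, hs]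
    exact TensorProduct.tmul_zero _ _

end IwasawaAlgebra

namespace VoltageDatum

open IwasawaAlgebra

variable {p : ℕ} [Fact p.Prime] {Γ : Type*} [CommGroup Γ] {γ : Γ} (T : VoltageDatum.{u, v} Γ)

section

variable [Fintype T.X.V] [DecidableEq T.X.V]

theorem degPicP_picOfFree (hγ : IsProcyclicGenerator p γ) (n : ℕ)
    (f : T.X.V → IwasawaAlgebra p Γ) :
    T.degPicP p n (T.picOfFree p n f) = augmentation p Γ n (∑ v, f v) := by
  have key : (T.degPicP p n).comp (T.picOfFree p n).toAddMonoidHom =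
      (augmentation p Γ n).toAddMonoidHom.comp
        (∑ v, Pi.evalAddMonoidHom (fun _ : T.X.V => IwasawaAlgebra p Γ) v) := by
    refine AddMonoidHom.functions_ext _ _ _ fun v a => ?_
    rw [AddMonoidHom.comp_apply, AddMonoidHom.comp_apply, AddMonoidHom.finsetSum_apply]
    simp only [Pi.evalAddMonoidHom_apply, Finset.sum_pi_single', Finset.mem_univ, if_true]
    change T.degPicP p n (T.picOfFree p n (Pi.single v a)) = augmentation p Γ n a
    obtain ⟨b, y, rfl⟩ := exists_eq_algebraMap_add hγ n a
    have hy : (Pi.single v (omega p γ n * y) : T.X.V → IwasawaAlgebra p Γ) =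
        omega p γ n • Pi.single v y := by
      rw [← Pi.single_smul', smul_eq_mul]
    rw [Pi.single_add, map_add, hy, map_smul, omega_smul_eq_zero, add_zero, map_add,
      augmentation_omega_mul, add_zero, augmentation_algebraMap]
    induction b using MonoidAlgebra.induction_linear with
    | zero => simp
    | add b c hb hc => rw [map_add, Pi.single_add, map_add, map_add, hb, hc, map_add]
    | single g r =>
      rw [algebraMap_single, picOfFree_single, degPicP_tmul, SerreGraph.degPic_mk,
        SerreGraph.deg_vertex, MonoidAlgebra.lift_single]
      simp
  refine (DFunLike.congr_fun key f).trans ?_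
  rw [AddMonoidHom.comp_apply, AddMonoidHom.finsetSum_apply]
  rfl

omit [DecidableEq T.X.V] in
theorem degLambda_ofFree (f : T.X.V → IwasawaAlgebra p Γ) :
    T.degLambda p (T.ofFree p f) = (∑ v, f v) • trivialOne p Γ := by
  rw [ofFree, Fintype.linearCombination_apply, map_sum, Finset.sum_smul]
  refine Finset.sum_congr rfl fun v _ => ?_
  rw [map_smul]
  congr 1
  change (1 : IwasawaAlgebra p Γ) ⊗ₜ[MonoidAlgebra ℤ_[p] Γ] (show TrivialZp p Γ from
    T.Xinf.deg (T.Xinf.vertex (T.vertexInf v 1)) • (1 : ℤ_[p])) = trivialOne p Γ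
  rw [SerreGraph.deg_vertex, one_smul]
  rfl

end

variable [Finite T.X.V]

/-- The degree condition defining `Div⁰_Λ(X_∞)` can be checked on `Pic_p(X_n)`, for any `n`. -/
theorem mem_Div0Lambda_iff (hγ : IsProcyclicGenerator p γ) (n : ℕ) (D : T.DivLambda p) :
    D ∈ T.Div0Lambda p ↔ T.degPicP p n (T.picMkLambda p n (T.piLambda p n D)) = 0 := by
  classical
  have := Fintype.ofFinite T.X.V
  obtain ⟨f, rfl⟩ := T.ofFree_surjective D
  have h := T.degPicP_picOfFree hγ n f
  rw [Div0Lambda, LinearMap.mem_ker, degLambda_ofFree, smul_trivialOne_eq_zero_iff hγ n, ← h]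
  rfl

/-- The map `Div⁰_Λ(X_∞) → Pic⁰_p(X_n)` induced by `π_n`, obtained by identifying `Pic⁰_p(X_n)` with
a submodule of `Pic_p(X_n)`. -/
def toPic0P (hγ : IsProcyclicGenerator p γ) (n : ℕ) :
    T.Div0Lambda p →ₗ[IwasawaAlgebra p Γ] T.Pic0P p n :=
  (LinearEquiv.ofInjective _ (T.pic0ToPicLambda_injective n)).symm.toLinearMap ∘ₗ
    (T.picMkLambda p n ∘ₗ T.piLambda p n ∘ₗ (T.Div0Lambda p).subtype).codRestrict
      (LinearMap.range (T.pic0ToPicLambda p n)) fun D =>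
        (T.degPicP_eq_zero_iff n _).mp ((T.mem_Div0Lambda_iff hγ n D).mp D.2)

theorem pic0ToPicLambda_toPic0P (hγ : IsProcyclicGenerator p γ) (n : ℕ) (D : T.Div0Lambda p) :
    T.pic0ToPicLambda p n (T.toPic0P hγ n D) = T.picMkLambda p n (T.piLambda p n D) := by
  rw [toPic0P, LinearMap.comp_apply, LinearEquiv.coe_coe]
  exact congrArg Subtype.val (LinearEquiv.apply_symm_apply
    (LinearEquiv.ofInjective _ (T.pic0ToPicLambda_injective n)) _)

theorem toPic0P_eq_zero_iff (hγ : IsProcyclicGenerator p γ) (n : ℕ) (D : T.Div0Lambda p) :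
    T.toPic0P hγ n D = 0 ↔ T.picMkLambda p n (T.piLambda p n D) = 0 := by
  rw [← pic0ToPicLambda_toPic0P T hγ, map_eq_zero_iff _ (T.pic0ToPicLambda_injective n)]

omit [Finite T.X.V] in
theorem pic0ToPicLambda_pic0Trans (n : ℕ) (x : T.Pic0P p (n + 1)) :
    T.pic0ToPicLambda p n (T.pic0Trans p n x) =
      T.picTrans p n (T.pic0ToPicLambda p (n + 1) x) := by
  induction x using PExt.induction with
  | h0 => simp only [map_zero]
  | h1 a x =>
    induction x using QuotientAddGroup.induction_on with | H D => rfl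
  | h2 x y hx hy => simp only [map_add, hx, hy]

/-- The map `Div⁰_Λ(X_∞) → Pic⁰_Λ` induced by the `π_n`. -/
def toPic0Lambda (hγ : IsProcyclicGenerator p γ) :
    T.Div0Lambda p →ₗ[IwasawaAlgebra p Γ] T.Pic0Lambda p :=
  (LinearMap.pi fun n => T.toPic0P hγ n).codRestrict (T.Pic0Lambda p) fun D n => by
    classical
    have := Fintype.ofFinite T.X.V
    apply T.pic0ToPicLambda_injective n
    rw [pic0ToPicLambda_pic0Trans]
    change T.picTrans p n (T.pic0ToPicLambda p (n + 1) (T.toPic0P hγ (n + 1) D)) =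
      T.pic0ToPicLambda p n (T.toPic0P hγ n D)
    rw [pic0ToPicLambda_toPic0P, pic0ToPicLambda_toPic0P, picTrans_picMkLambda]

theorem toPic0P_surjective (hγ : IsProcyclicGenerator p γ) (n : ℕ) :
    Function.Surjective (T.toPic0P hγ n) := by
  classical
  have := Fintype.ofFinite T.X.V
  intro x
  obtain ⟨f, hf⟩ := T.picOfFree_surjective n (T.pic0ToPicLambda p n x)
  refine ⟨⟨T.ofFree p f, (T.mem_Div0Lambda_iff hγ n _).mpr ?_⟩, ?_⟩
  · exact (T.degPicP_eq_zero_iff n _).mpr ⟨x, hf.symm⟩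
  · apply T.pic0ToPicLambda_injective n
    rw [pic0ToPicLambda_toPic0P]
    exact hf

theorem toPic0Lambda_surjective [Finite T.X.E] (hγ : IsProcyclicGenerator p γ)
    (hI : ∀ v, T.Ramified v → T.I v = (powMonoidHom (p ^ T.ramExp p v) : Γ →* Γ).range) :
    Function.Surjective (T.toPic0Lambda hγ) := by
  classical
  have := Fintype.ofFinite T.X.V
  have : ∀ v, Fintype (T.X.star v) := fun v => Fintype.ofFinite _
  rintro ⟨x, hx⟩
  obtain ⟨D, hD⟩ := T.toPicLambda_surjective hγ hI
    ⟨fun n => T.pic0ToPicLambda p n (x n), fun n => by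
      rw [← pic0ToPicLambda_pic0Trans, hx n]⟩
  have hD' : ∀ n, T.picMkLambda p n (T.piLambda p n D) = T.pic0ToPicLambda p n (x n) := fun n =>
    congrFun (congrArg Subtype.val hD) n
  refine ⟨⟨D, (T.mem_Div0Lambda_iff hγ 0 _).mpr ?_⟩, Subtype.ext (funext fun n => ?_)⟩
  · exact (T.degPicP_eq_zero_iff 0 _).mpr ⟨x 0, (hD' 0).symm⟩
  · apply T.pic0ToPicLambda_injective n
    exact (T.pic0ToPicLambda_toPic0P hγ n _).trans (hD' n)

end VoltageDatum

end

theorem corollary5p3 (p : ℕ) [Fact p.Prime] {Γ : Type*} [CommGroup Γ] [TopologicalSpace Γ]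
    [IsTopologicalGroup Γ] (hΓ : Nonempty (Γ ≃ₜ* Multiplicative ℤ_[p]))
    (γ : Γ) (hγ : Dense (Subgroup.zpowers γ : Set Γ))
    (T : VoltageDatum Γ) [Finite T.X.V] [Finite T.X.E] (hX : T.X.Connected)
    (hI : ∀ v, IsClosed (T.I v : Set Γ)) (hconn : ∀ n, (T.level p n).Connected) :
    -- finite level: `π_n` induces `Div_Λ / N_n ≃ Pic_p(X_n)` and `Div⁰_Λ / N_n ≃ Pic⁰_p(X_n)`
    (∀ n, (∀ v, T.Ramified v → T.ramExp p v ≤ n) →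
      (∃ e : (T.DivLambda p ⧸ T.N p γ n) ≃ₗ[IwasawaAlgebra p Γ] T.PicP p n,
        ∀ D : T.DivLambda p, e (Submodule.Quotient.mk D) = T.picMk p n (T.piLambda p n D)) ∧
      T.N p γ n ≤ T.Div0Lambda p ∧
      (∃ e : (T.Div0Lambda p ⧸ (T.N p γ n).submoduleOf (T.Div0Lambda p))
          ≃ₗ[IwasawaAlgebra p Γ] T.Pic0P p n,
        ∀ D : T.Div0Lambda p, T.pic0ToPic p n (e (Submodule.Quotient.mk D)) =
          T.picMk p n (T.piLambda p n D))) ∧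
    -- infinite level: `Pic_Λ ≃ Div_Λ / Pr_Λ^unr` and `Pic⁰_Λ ≃ Div⁰_Λ / Pr_Λ^unr`
    (∃ e : (T.DivLambda p ⧸ T.PrUnr p) ≃ₗ[IwasawaAlgebra p Γ] T.PicLambda p,
      ∀ (D : T.DivLambda p) (n : ℕ),
        (e (Submodule.Quotient.mk D)).1 n = T.picMk p n (T.piLambda p n D)) ∧
    T.PrUnr p ≤ T.Div0Lambda p ∧
    (∃ e : (T.Div0Lambda p ⧸ (T.PrUnr p).submoduleOf (T.Div0Lambda p))
        ≃ₗ[IwasawaAlgebra p Γ] T.Pic0Lambda p,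
      ∀ (D : T.Div0Lambda p) (n : ℕ),
        T.pic0ToPic p n ((e (Submodule.Quotient.mk D)).1 n) =
          T.picMk p n (T.piLambda p n D)) := by
  classical
  obtain ⟨L⟩ := hΓ
  have hγ' := isProcyclicGenerator_of_dense L hγ
  have hI' : ∀ v, T.Ramified v → T.I v = (powMonoidHom (p ^ T.ramExp p v) : Γ →* Γ).range :=
    fun v hv => Nat.sInf_mem (s := {k | T.I v = (powMonoidHom (p ^ k) : Γ →* Γ).range})
      (exists_eq_range_powMonoidHom L (hI v) hv)
  have := Fintype.ofFinite T.X.V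
  have : ∀ v, Fintype (T.X.star v) := fun v => Fintype.ofFinite _
  have hN : ∀ n, T.N p γ n ≤ T.Div0Lambda p := fun n D hD => by
    rw [T.mem_Div0Lambda_iff hγ' n, (T.picMkLambda_piLambda_eq_zero_iff hγ' hI' n D).mpr hD,
      map_zero]
  refine ⟨fun n _ => ⟨?_, hN n, ?_⟩, ?_, le_sup_right.trans (hN 0), ?_⟩
  · refine LinearMap.exists_quotientEquiv (f := T.picMkLambda p n ∘ₗ T.piLambda p n) (fun x => ?_)
      (T.picMkLambda_piLambda_eq_zero_iff hγ' hI' n)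
    obtain ⟨f, hf⟩ := T.picOfFree_surjective n x
    exact ⟨T.ofFree p f, hf⟩
  · obtain ⟨e, he⟩ := LinearMap.exists_quotientEquiv (T.toPic0P_surjective hγ' n)
      (S := (T.N p γ n).submoduleOf (T.Div0Lambda p)) fun D =>
        (T.toPic0P_eq_zero_iff hγ' n D).trans
          (T.picMkLambda_piLambda_eq_zero_iff hγ' hI' n D)
    exact ⟨e, fun D => by rw [he]; exact T.pic0ToPicLambda_toPic0P hγ' n D⟩
  · obtain ⟨e, he⟩ := LinearMap.exists_quotientEquiv (T.toPicLambda_surjective hγ' hI')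
      (S := T.PrUnr p) fun D => by
        rw [← T.forall_picMkLambda_eq_zero_iff hγ' hI', Subtype.ext_iff, funext_iff]
        rfl
    exact ⟨e, fun D n => by rw [he]; rfl⟩
  · obtain ⟨e, he⟩ := LinearMap.exists_quotientEquiv (T.toPic0Lambda_surjective hγ' hI')
      (S := (T.PrUnr p).submoduleOf (T.Div0Lambda p)) fun D => by
        refine Iff.trans ?_ (T.forall_picMkLambda_eq_zero_iff hγ' hI' D)
        rw [Subtype.ext_iff, funext_iff]
        exact forall_congr' fun n => T.toPic0P_eq_zero_iff hγ' n D
    exact ⟨e, fun D n => by rw [he]; exact T.pic0ToPicLambda_toPic0P hγ' n D⟩
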